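/- **Setting.** Let $n\ge 1$ be an integer, $\Omega\subset\mathbb{R}^n$ open, and $Q_0=(-\tfrac12,\tfrac12)^n$. For an open set $U$ put $$|Df|(U)=\sup\Big\{\int_U f\,\mathrm{div}\,\varphi\,dx:\ \varphi\in C^1_c(U;\mathbb{R}^n),\ \|\varphi\|_\infty\le 1\Big\}.$$ We write $f\in BV(U)$ if $f\in L^1(U)$ and $|Df|(U)<\infty$, and $f\in BV_{\mathrm{loc}}(\Omega)$ if $f\in L^1_{\mathrm{loc}}(\Omega)$ and $|Df|(U)<\infty$ for every open $U$ whose closure is a compact subset of $\Omega$; in the latter case $|Df|$ also denotes the associated Radon measure on $\Omega$, and $\mathrm{spt}|Df|\subset\Omega$ is its (relatively closed) support in $\Omega$. A cube is an open cube with arbitrary orthogonal axes. It is oriented if it is equipped with a similarity $T_Q(y)=x_Q+\ell(Q)R_Qy$, $R_Q\in O(n)$, such that $T_Q(Q_0)=Q$; here $x_Q$ is the centre and $\ell(Q)>0$ the sidelength of $Q$. For $\tau\in[0,1)$ let $\tau Q=T_Q(\tau Q_0)$ be the concentric contraction of $Q$ (so $0Q=\{x_Q\}$). If $f\in BV(Q)$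 and $|Df|(Q)>0$, define $f_Q\colon Q_0\to\mathbb{R}$ by $$f_Q(y)=\frac{\ell(Q)^{n-1}}{|Df|(Q)}\Big(f(T_Qy)-\frac{1}{|Q|}\int_Q f\,dx\Big).$$ For $f\in BV_{\mathrm{loc}}(\Omega)$ and $x\in\mathrm{spt}|Df|$, let $\mathrm{Tan}^\tau(f,x)$ be the set of all $u\in L^1(Q_0)$, called $\tau$-tangents of $f$ at $x$, for which there are oriented cubes $Q_j\subset\Omega$ with $f\in BV(Q_j)$, $|Df|(Q_j)>0$, $x\in\tau Q_j$, $\ell(Q_j)\to0$ and $f_{Q_j}\to u$ in $L^1(Q_0)$ as $j\to\infty$. If $x\notin\mathrm{spt}|Df|$, put $\mathrm{Tan}^\tau(f,x)=\emptyset$. Every $\tau$-tangent $u$ belongs to $BV(Q_0)$, and $\mathrm{spt}|Du|\subset Q_0$ and $\mathrm{Tan}^\tau(u,y)$ are understood with $Q_0$ in place of $\Omega$. **Proposition 5.8.** Let $f\in BV_{\mathrm{loc}}(\Omega)$ and $\tau\in[0,1)$. Then for $|Df|$-almost every $a\in\Omega$, every $u\in\mathrm{Tan}^\tau(f,a)$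 has the following properties: 1. $u_Q\in\mathrm{Tan}^\tau(f,a)$ for all oriented cubes $Q\subset Q_0$ with $\tau Q\cap\mathrm{spt}|Du|\ne\emptyset$; 2. $\mathrm{Tan}^\tau(u,y)\subseteq\mathrm{Tan}^\tau(f,a)$ for every $y\in\mathrm{spt}|Du|$. -/

import Mathlib

open MeasureTheory Filter Topology
open scoped ENNReal

noncomputable section

namespace BVTangent

/-- `ℝⁿ` with its Euclidean norm. -/
abbrev Rn (n : ℕ) : Type := EuclideanSpace ℝ (Fin n)

/-! ### Functions of bounded variation -/

/-- The divergence `∑ᵢ ∂ᵢ φᵢ` of a vector field on `ℝⁿ`. -/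
def divergence {n : ℕ} (φ : Rn n → Rn n) (x : Rn n) : ℝ :=
  ∑ i, (fderiv ℝ φ x (EuclideanSpace.single i 1)) i

/-- The test fields `φ ∈ C¹_c(U; ℝⁿ)` with `‖φ‖_∞ ≤ 1`. -/
structure IsTestField {n : ℕ} (U : Set (Rn n)) (φ : Rn n → Rn n) : Prop where
  contDiff : ContDiff ℝ 1 φ
  hasCompactSupport : HasCompactSupport φ
  tsupport_subset : tsupport φ ⊆ U
  norm_le_one : ∀ x, ‖φ x‖ ≤ 1

/-- The total variation `|Df|(U) = sup { ∫_U f div φ : φ ∈ C¹_c(U; ℝⁿ), ‖φ‖_∞ ≤ 1 }` of `f` in an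
open set `U`. (The field `φ = 0` is admissible, so truncating the integrals at `0` does not affect
the supremum.) -/
def variation {n : ℕ} (f : Rn n → ℝ) (U : Set (Rn n)) : ℝ≥0∞ :=
  ⨆ (φ : Rn n → Rn n) (_ : IsTestField U φ), ENNReal.ofReal (∫ x in U, f x * divergence φ x)

/-- `f ∈ BV(U)`. -/
def IsBV {n : ℕ} (f : Rn n → ℝ) (U : Set (Rn n)) : Prop :=
  IntegrableOn f U ∧ variation f U < ∞

/-- `f ∈ BV_loc(Ω)`: `f ∈ L¹_loc(Ω)`, and `f` has finite variation in each open set which is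
compactly contained in `Ω`. -/
def IsBVLoc {n : ℕ} (f : Rn n → ℝ) (Ω : Set (Rn n)) : Prop :=
  LocallyIntegrableOn f Ω ∧
    ∀ U : Set (Rn n), IsOpen U → IsCompact (closure U) → closure U ⊆ Ω → variation f U < ∞

theorem variation_empty_inter {n : ℕ} (f : Rn n → ℝ) (Ω : Set (Rn n)) :
    variation f (∅ ∩ Ω) = 0 := by
  simp [variation]

/-- The total variation measure `|Df|` on `Ω`, extended by `0` outside `Ω`, as the outer measure
generated by its values `U ↦ |Df|(U ∩ Ω)` on the open sets `U`. For `f ∈ BV_loc(Ω)` these values are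
countably subadditive, so that `|Df|(B) = inf { |Df|(U) : B ⊆ U ⊆ Ω, U open }` for every `B ⊆ Ω`,
and on Borel subsets of `Ω` this is the usual Radon measure `|Df|`. -/
def totalVariation {n : ℕ} (f : Rn n → ℝ) (Ω : Set (Rn n)) : OuterMeasure (Rn n) :=
  OuterMeasure.restrict Ω
    (inducedOuterMeasure (P := IsOpen) (fun U _ => variation f (U ∩ Ω)) isOpen_empty
      (variation_empty_inter f Ω))

/-- The support `spt |Df|` of the total variation measure of `f` on the open set `Ω`: the points
of `Ω` all of whose open neighbourhoods in `Ω` have positive measure. -/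
def spt {n : ℕ} (f : Rn n → ℝ) (Ω : Set (Rn n)) : Set (Rn n) :=
  {x | x ∈ Ω ∧ ∀ U : Set (Rn n), IsOpen U → U ⊆ Ω → x ∈ U → 0 < variation f U}

/-! ### Oriented cubes -/

/-- The unit cube `Q₀ = (-1/2, 1/2)ⁿ`. -/
def unitCube (n : ℕ) : Set (Rn n) := {y | ∀ i, |y i| < 1 / 2}

/-- An oriented open cube in `ℝⁿ`, with arbitrary axes. It is given by its centre, its
sidelength, and the orthogonal map `e` for which the points `center + (side / 2) • e eᵢ` are the
chosen centres of faces (the orientation). -/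
structure OrientedCube (n : ℕ) where
  center : Rn n
  side : ℝ
  side_pos : 0 < side
  frame : Rn n ≃ₗᵢ[ℝ] Rn n

namespace OrientedCube

/-- The similarity `T_Q` that maps `Q₀` onto `Q` and preserves the orientations. -/
def map {n : ℕ} (Q : OrientedCube n) (y : Rn n) : Rn n := Q.center + Q.side • Q.frame y

/-- The open cube itself, as a set. -/
def carrier {n : ℕ} (Q : OrientedCube n) : Set (Rn n) := Q.map '' unitCube n

/-- The concentric contraction `τQ`, i.e. the image of `τQ₀` under `T_Q`. It is an open cube of
sidelength `τ ℓ(Q)` if `τ > 0`, and the centre of `Q` if `τ = 0`. -/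
def contraction {n : ℕ} (τ : ℝ) (Q : OrientedCube n) : Set (Rn n) :=
  (fun y => Q.map (τ • y)) '' unitCube n

end OrientedCube

/-! ### Rescalings and tangents -/

/-- The rescaling `f_Q(y) = |Df|(Q)⁻¹ (f(T_Q y) - ⨍_Q f) ℓ(Q)ⁿ⁻¹`, for `n ≥ 1`, `f ∈ BV(Q)` and
`|Df|(Q) > 0`; only the values for `y ∈ Q₀` are relevant. -/
def rescale {n : ℕ} (f : Rn n → ℝ) (Q : OrientedCube n) (y : Rn n) : ℝ :=
  1 / (variation f Q.carrier).toReal * (f (Q.map y) - ⨍ x in Q.carrier, f x) * Q.side ^ (n - 1)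

/-- `f_{Q_0}, f_{Q_1}, …` is a `τ`-centered blow-up sequence of `f : Ω → ℝ` at `x`. -/
structure IsBlowUp {n : ℕ} (τ : ℝ) (f : Rn n → ℝ) (Ω : Set (Rn n)) (x : Rn n)
    (Q : ℕ → OrientedCube n) : Prop where
  subset : ∀ j, (Q j).carrier ⊆ Ω
  isBV : ∀ j, IsBV f (Q j).carrier
  variation_pos : ∀ j, 0 < variation f (Q j).carrier
  mem_contraction : ∀ j, x ∈ (Q j).contraction τ
  side_tendsto : Tendsto (fun j => (Q j).side) atTop (𝓝 0)

/-- The set `Tan^τ(f, x)` of `τ`-tangents of `f : Ω → ℝ` at `x`: the limits in `L¹(Q₀)` of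
`τ`-centered blow-up sequences if `x ∈ spt |Df|`, and `∅` otherwise. Elements of `L¹(Q₀)` are
given by arbitrary representatives `ℝⁿ → ℝ`, whose values outside `Q₀` play no role. -/
def Tan {n : ℕ} (τ : ℝ) (f : Rn n → ℝ) (Ω : Set (Rn n)) (x : Rn n) : Set (Rn n → ℝ) :=
  {u | x ∈ spt f Ω ∧ IntegrableOn u (unitCube n) ∧
    ∃ Q : ℕ → OrientedCube n, IsBlowUp τ f Ω x Q ∧
      Tendsto (fun j => ∫⁻ y in unitCube n, ‖rescale f (Q j) y - u y‖ₑ) atTop (𝓝 0)}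

end BVTangent

end

noncomputable section

namespace BVTangent

open scoped Manifold

/-! ### Vector fields of class `C¹_c` -/

/-! This is Preiss's principle that tangents of tangents are tangents. If `f_{Q_j} → u` and `τR`
meets `spt |Du|`, then `f_{Q_j ∘ R}` is a rescaling of `f_{Q_j}` and should converge to `u_R`.
However, `a` need not lie in the contraction of `Q_j ∘ R`, so a density argument is needed. By
separability of `L¹(Q₀)` the points where the first assertion fails are covered, up to a null set,
by countably many sets `A` (`isolatedSet`): at `a ∈ A` some `u_R` is `ε`-close to a fixed `g`,
whereas all rescalings of `f` in small admissible cubes at `a` stay `2ε`-away from `g`. For `x` near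
a point of `spt |Du|` in `τR`, a slight perturbation `P` of `R` has `x` in its contraction, and
`f_{Q_j ∘ P}` is close to `u_R`; hence `T_{Q_j} x ∉ A`. So `A` misses an open subset of `Q_j`
carrying a definite fraction of `|Df|(Q_j)`, at arbitrarily small scales, and such a set is null
(`outerVariation_sparse_eq_zero`).

The analytic point is that `L¹` convergence does not control the normalizing factors `|Df|(Q_j ∘ P)
/ |Df|(Q_j)`. Lower semicontinuity gives one inequality. For the other, at almost every `a` the
derivative of `f` in small cubes has almost one direction `e`
(`outerVariation_not_isUnidirectional`), so that its mass is nearly a pairing with a field `η e`,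
which passes to the limit (`eventually_relVariation_le`). Shrinking the perturbed cubes slightly
into the interior of `R` keeps mass near the boundary of `R` out of the limit.

Both almost everywhere statements come from `exists_outerVariation_le_of_competitors`, without polar
decomposition or differentiation of measures. Local improvements of an almost optimal test field, in
cubes from a Morse covering of overlap at most `N`, are added up; their total gain is at most `N`
times the deficit of the field.

The second assertion follows from the first since `Tan^τ(f, a)` is closed in `L¹(Q₀)`. -/

/-- The vector fields `φ ∈ C¹_c(U; ℝⁿ)`. -/
structure IsField {n : ℕ} (U : Set (Rn n)) (φ : Rn n → Rn n) : Prop where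
  contDiff : ContDiff ℝ 1 φ
  hasCompactSupport : HasCompactSupport φ
  tsupport_subset : tsupport φ ⊆ U

theorem IsTestField.isField {n : ℕ} {U : Set (Rn n)} {φ : Rn n → Rn n} (h : IsTestField U φ) :
    IsField U φ :=
  ⟨h.contDiff, h.hasCompactSupport, h.tsupport_subset⟩

theorem IsField.isTestField {n : ℕ} {U : Set (Rn n)} {φ : Rn n → Rn n} (h : IsField U φ)
    (h1 : ∀ x, ‖φ x‖ ≤ 1) : IsTestField U φ :=
  ⟨h.contDiff, h.hasCompactSupport, h.tsupport_subset, h1⟩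

theorem IsField.mono {n : ℕ} {U V : Set (Rn n)} {φ : Rn n → Rn n} (h : IsField U φ)
    (hUV : U ⊆ V) : IsField V φ :=
  ⟨h.contDiff, h.hasCompactSupport, h.tsupport_subset.trans hUV⟩

theorem IsTestField.mono {n : ℕ} {U V : Set (Rn n)} {φ : Rn n → Rn n} (h : IsTestField U φ)
    (hUV : U ⊆ V) : IsTestField V φ :=
  (h.isField.mono hUV).isTestField h.norm_le_one

theorem IsField.zero {n : ℕ} (U : Set (Rn n)) : IsField U (fun _ => (0 : Rn n)) :=
  ⟨contDiff_const, HasCompactSupport.zero, by simp⟩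

theorem IsTestField.zero {n : ℕ} (U : Set (Rn n)) : IsTestField U (fun _ => (0 : Rn n)) :=
  (IsField.zero U).isTestField (by simp)

theorem IsField.add {n : ℕ} {U : Set (Rn n)} {φ ψ : Rn n → Rn n} (hφ : IsField U φ)
    (hψ : IsField U ψ) : IsField U (fun x => φ x + ψ x) :=
  ⟨hφ.contDiff.add hψ.contDiff, hφ.hasCompactSupport.add hψ.hasCompactSupport,
    (tsupport_add φ ψ).trans (Set.union_subset hφ.tsupport_subset hψ.tsupport_subset)⟩

theorem tsupport_smul_field_subset_left {n : ℕ} (η : Rn n → ℝ) (φ : Rn n → Rn n) :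
    tsupport (fun x => η x • φ x) ⊆ tsupport η :=
  closure_mono fun x hx => by
    simp only [Function.mem_support] at hx ⊢
    exact fun h => hx (by simp [h])

theorem tsupport_smul_field_subset_right {n : ℕ} (η : Rn n → ℝ) (φ : Rn n → Rn n) :
    tsupport (fun x => η x • φ x) ⊆ tsupport φ :=
  closure_mono fun x hx => by
    simp only [Function.mem_support] at hx ⊢
    exact fun h => hx (by simp [h])

theorem IsField.smul {n : ℕ} {U : Set (Rn n)} {φ : Rn n → Rn n} (hφ : IsField U φ)
    {η : Rn n → ℝ} (hη : ContDiff ℝ 1 η) : IsField U (fun x => η x • φ x) :=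
  ⟨hη.smul hφ.contDiff, hφ.hasCompactSupport.mono' (subset_closure.trans
    (tsupport_smul_field_subset_right η φ)),
    (tsupport_smul_field_subset_right η φ).trans hφ.tsupport_subset⟩

theorem IsField.cutoff_smul {n : ℕ} {U : Set (Rn n)} {φ : Rn n → Rn n} (hφ : ContDiff ℝ 1 φ)
    {η : Rn n → ℝ} (hη : ContDiff ℝ 1 η) (hc : HasCompactSupport η) (hU : tsupport η ⊆ U) :
    IsField U (fun x => η x • φ x) :=
  ⟨hη.smul hφ, hc.mono' (subset_closure.trans
    (tsupport_smul_field_subset_left η φ)),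
    (tsupport_smul_field_subset_left η φ).trans hU⟩

theorem IsField.const_smul {n : ℕ} {U : Set (Rn n)} {φ : Rn n → Rn n} (hφ : IsField U φ)
    (c : ℝ) : IsField U (fun x => c • φ x) :=
  hφ.smul contDiff_const

theorem IsField.sub {n : ℕ} {U : Set (Rn n)} {φ ψ : Rn n → Rn n} (hφ : IsField U φ)
    (hψ : IsField U ψ) : IsField U (fun x => φ x - ψ x) := by
  simpa [sub_eq_add_neg] using hφ.add (hψ.const_smul (-1))

theorem IsField.sum {n : ℕ} {U : Set (Rn n)} {ι : Type*} (s : Finset ι) {φ : ι → Rn n → Rn n}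
    (hφ : ∀ i ∈ s, IsField U (φ i)) : IsField U (fun x => ∑ i ∈ s, φ i x) := by
  classical
  induction s using Finset.induction_on with
  | empty => simpa using IsField.zero U
  | insert a s ha ih =>
    simp only [Finset.sum_insert ha]
    exact (hφ a (by simp)).add (ih fun i hi => hφ i (by simp [hi]))

theorem IsField.differentiableAt {n : ℕ} {U : Set (Rn n)} {φ : Rn n → Rn n} (hφ : IsField U φ)
    (x : Rn n) : DifferentiableAt ℝ φ x :=
  (hφ.contDiff.differentiable one_ne_zero) x

/-! ### The divergence -/

theorem divergence_add {n : ℕ} {φ ψ : Rn n → Rn n} {x : Rn n} (hφ : DifferentiableAt ℝ φ x)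
    (hψ : DifferentiableAt ℝ ψ x) :
    divergence (fun x => φ x + ψ x) x = divergence φ x + divergence ψ x := by
  simp [divergence, fderiv_fun_add hφ hψ, Finset.sum_add_distrib]

theorem divergence_const_smul {n : ℕ} {φ : Rn n → Rn n} {x : Rn n} (c : ℝ)
    (hφ : DifferentiableAt ℝ φ x) :
    divergence (fun x => c • φ x) x = c * divergence φ x := by
  simp [divergence, fderiv_fun_const_smul hφ, Finset.mul_sum]

theorem divergence_zero {n : ℕ} (x : Rn n) : divergence (fun _ => (0 : Rn n)) x = 0 := by
  simp [divergence]

theorem divergence_of_notMem_tsupport {n : ℕ} {φ : Rn n → Rn n} {x : Rn n}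
    (hx : x ∉ tsupport φ) : divergence φ x = 0 := by
  simp [divergence, fderiv_of_notMem_tsupport (𝕜 := ℝ) hx]

theorem IsField.continuous_divergence {n : ℕ} {U : Set (Rn n)} {φ : Rn n → Rn n}
    (hφ : IsField U φ) : Continuous (divergence φ) := by
  have h := hφ.contDiff.continuous_fderiv one_ne_zero
  unfold divergence
  fun_prop

theorem IsField.exists_bound_divergence {n : ℕ} {U : Set (Rn n)} {φ : Rn n → Rn n}
    (hφ : IsField U φ) : ∃ C, 0 ≤ C ∧ ∀ x, |divergence φ x| ≤ C := by
  have hc : HasCompactSupport (divergence φ) :=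
    hφ.hasCompactSupport.mono' fun x hx => by
      by_contra h
      exact hx (divergence_of_notMem_tsupport h)
  obtain ⟨C, hC⟩ := hφ.continuous_divergence.bounded_above_of_compact_support hc
  exact ⟨C, (norm_nonneg _).trans (hC 0), hC⟩

/-! ### The pairing of a function with the divergence of a field -/

/-- `∫ f div φ`. -/
def pairing {n : ℕ} (f : Rn n → ℝ) (φ : Rn n → Rn n) : ℝ := ∫ x, f x * divergence φ x

theorem setIntegral_eq_pairing {n : ℕ} (f : Rn n → ℝ) {U : Set (Rn n)} {φ : Rn n → Rn n}
    (hφ : tsupport φ ⊆ U) : ∫ x in U, f x * divergence φ x = pairing f φ :=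
  setIntegral_eq_integral_of_forall_compl_eq_zero fun x hx => by
    simp [divergence_of_notMem_tsupport fun h => hx (hφ h)]

theorem variation_eq_iSup_pairing {n : ℕ} (f : Rn n → ℝ) (U : Set (Rn n)) :
    variation f U = ⨆ (φ : Rn n → Rn n) (_ : IsTestField U φ), ENNReal.ofReal (pairing f φ) := by
  unfold variation
  exact iSup_congr fun φ => iSup_congr fun h => by
    rw [setIntegral_eq_pairing f h.tsupport_subset]

theorem IsField.integrable {n : ℕ} {f : Rn n → ℝ} {U : Set (Rn n)} {φ : Rn n → Rn n}
    (hφ : IsField U φ) (hf : LocallyIntegrableOn f U) :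
    Integrable fun x => f x * divergence φ x := by
  have hK : IsCompact (tsupport φ) := hφ.hasCompactSupport
  have h1 : IntegrableOn (fun x => f x * divergence φ x) (tsupport φ) :=
    (hf.integrableOn_compact_subset hφ.tsupport_subset hK).mul_continuousOn
      hφ.continuous_divergence.continuousOn hK
  refine (integrableOn_iff_integrable_of_support_subset fun x hx => ?_).1 h1
  by_contra h
  exact hx (by simp [divergence_of_notMem_tsupport h])

theorem pairing_zero {n : ℕ} (f : Rn n → ℝ) : pairing f (fun _ => (0 : Rn n)) = 0 := by
  simp [pairing, divergence_zero]

theorem pairing_add {n : ℕ} {f : Rn n → ℝ} {U : Set (Rn n)} (hf : LocallyIntegrableOn f U)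
    {φ ψ : Rn n → Rn n} (hφ : IsField U φ) (hψ : IsField U ψ) :
    pairing f (fun x => φ x + ψ x) = pairing f φ + pairing f ψ := by
  unfold pairing
  rw [← integral_add (hφ.integrable hf) (hψ.integrable hf)]
  congr 1 with x
  rw [divergence_add (hφ.differentiableAt x) (hψ.differentiableAt x), mul_add]

theorem pairing_const_smul {n : ℕ} (f : Rn n → ℝ) {U : Set (Rn n)} {φ : Rn n → Rn n}
    (hφ : IsField U φ) (c : ℝ) : pairing f (fun x => c • φ x) = c * pairing f φ := by
  unfold pairing
  rw [← integral_const_mul]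
  congr 1 with x
  rw [divergence_const_smul c (hφ.differentiableAt x)]
  ring

theorem pairing_sub {n : ℕ} {f : Rn n → ℝ} {U : Set (Rn n)} (hf : LocallyIntegrableOn f U)
    {φ ψ : Rn n → Rn n} (hφ : IsField U φ) (hψ : IsField U ψ) :
    pairing f (fun x => φ x - ψ x) = pairing f φ - pairing f ψ := by
  have := pairing_add hf hφ (hψ.const_smul (-1))
  rw [pairing_const_smul f hψ] at this
  simpa [sub_eq_add_neg] using this

theorem pairing_sum {n : ℕ} {f : Rn n → ℝ} {U : Set (Rn n)} (hf : LocallyIntegrableOn f U)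
    {ι : Type*} (s : Finset ι) {φ : ι → Rn n → Rn n} (hφ : ∀ i ∈ s, IsField U (φ i)) :
    pairing f (fun x => ∑ i ∈ s, φ i x) = ∑ i ∈ s, pairing f (φ i) := by
  classical
  induction s using Finset.induction_on with
  | empty => simpa using pairing_zero f
  | insert a s ha ih =>
    simp only [Finset.sum_insert ha]
    have hs : ∀ i ∈ s, IsField U (φ i) := fun i hi => hφ i (by simp [hi])
    rw [pairing_add hf (hφ a (by simp)) (IsField.sum s hs), ih hs]

/-! ### Elementary properties of the variation -/

theorem ofReal_pairing_le_variation {n : ℕ} (f : Rn n → ℝ) {U : Set (Rn n)} {φ : Rn n → Rn n}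
    (hφ : IsTestField U φ) : ENNReal.ofReal (pairing f φ) ≤ variation f U := by
  rw [variation_eq_iSup_pairing]
  exact le_iSup₂_of_le φ hφ le_rfl

theorem variation_mono {n : ℕ} (f : Rn n → ℝ) {U V : Set (Rn n)} (hUV : U ⊆ V) :
    variation f U ≤ variation f V := by
  rw [variation_eq_iSup_pairing f U]
  exact iSup₂_le fun φ hφ => ofReal_pairing_le_variation f (hφ.mono hUV)

theorem pairing_le_variation {n : ℕ} {f : Rn n → ℝ} {U : Set (Rn n)} (hU : variation f U ≠ ∞)
    {φ : Rn n → Rn n} (hφ : IsTestField U φ) : pairing f φ ≤ (variation f U).toReal :=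
  (ENNReal.ofReal_le_iff_le_toReal hU).1 (ofReal_pairing_le_variation f hφ)

theorem pairing_le_mul_variation {n : ℕ} {f : Rn n → ℝ} {U : Set (Rn n)}
    (hU : variation f U ≠ ∞) {φ : Rn n → Rn n} (hφ : IsField U φ) {c : ℝ}
    (hc : ∀ x, ‖φ x‖ ≤ c) : pairing f φ ≤ c * (variation f U).toReal := by
  rcases ((norm_nonneg _).trans (hc 0)).eq_or_lt with h0 | h0
  · have : φ = fun _ => 0 := funext fun x => norm_le_zero_iff.1 (h0 ▸ hc x)
    simp [this, pairing_zero, ← h0]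
  · have h := pairing_le_variation hU ((hφ.const_smul c⁻¹).isTestField fun x => by
      rw [norm_smul, norm_inv, Real.norm_of_nonneg h0.le, inv_mul_le_iff₀ h0, mul_one]
      exact hc x)
    rwa [pairing_const_smul f hφ, inv_mul_le_iff₀ h0] at h

theorem exists_lt_pairing {n : ℕ} {f : Rn n → ℝ} {U : Set (Rn n)} {c : ℝ}
    (hc : ENNReal.ofReal c < variation f U) :
    ∃ φ, IsTestField U φ ∧ c < pairing f φ := by
  rw [variation_eq_iSup_pairing, lt_iSup_iff] at hc
  obtain ⟨φ, hφ⟩ := hc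
  rw [lt_iSup_iff] at hφ
  obtain ⟨h, hlt⟩ := hφ
  exact ⟨φ, h, ENNReal.ofReal_lt_ofReal_iff'.1 hlt |>.1⟩

theorem exists_lt_pairing_of_lt_toReal {n : ℕ} {f : Rn n → ℝ} {U : Set (Rn n)} {c : ℝ}
    (hc : c < (variation f U).toReal) :
    ∃ φ, IsTestField U φ ∧ c < pairing f φ := by
  rcases lt_or_ge c 0 with h0 | h0
  · exact ⟨_, IsTestField.zero U, by rwa [pairing_zero]⟩
  · refine exists_lt_pairing ?_
    by_cases hU : variation f U = ∞
    · simp [hU]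
    · exact (ENNReal.ofReal_lt_iff_lt_toReal h0 hU).2 hc

/-! ### Subadditivity and superadditivity of the variation -/

/-- A test field has compact support, so finitely many `V i` suffice, and a smooth partition of
unity splits it into test fields for the individual `V i`. This is what makes the generated outer
measure agree with the variation on open sets. -/
theorem variation_iUnion_le {n : ℕ} {f : Rn n → ℝ} {Ω : Set (Rn n)}
    (hf : LocallyIntegrableOn f Ω) {V : ℕ → Set (Rn n)} (hV : ∀ i, IsOpen (V i))
    (hVΩ : ∀ i, V i ⊆ Ω) : variation f (⋃ i, V i) ≤ ∑' i, variation f (V i) := by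
  rw [variation_eq_iSup_pairing f (⋃ i, V i)]
  refine iSup₂_le fun φ hφ => ?_
  have hK : IsCompact (tsupport φ) := hφ.hasCompactSupport
  obtain ⟨t, ht⟩ := hK.elim_finite_subcover V hV hφ.tsupport_subset
  have ht' : tsupport φ ⊆ ⋃ i : t, V i := by
    intro x hx
    obtain ⟨i, hi, hxi⟩ := Set.mem_iUnion₂.1 (ht hx)
    exact Set.mem_iUnion.2 ⟨⟨i, hi⟩, hxi⟩
  obtain ⟨ρ, hρ⟩ := SmoothPartitionOfUnity.exists_isSubordinate 𝓘(ℝ, Rn n) hK.isClosed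
    (fun i : t => V i) (fun i => hV i) ht'
  have hρC : ∀ i, ContDiff ℝ 1 (ρ i) := fun i => by
    have : ContDiff ℝ ((⊤ : ℕ∞) : WithTop ℕ∞) (ρ i) := contMDiff_iff_contDiff.1 (ρ i).contMDiff
    exact this.of_le (by exact_mod_cast le_top)
  have hsum : φ = fun x => ∑ i : t, ρ i x • φ x := by
    funext x
    by_cases hx : x ∈ tsupport φ
    · have := ρ.sum_eq_one hx
      rw [finsum_eq_sum_of_fintype] at this
      rw [← Finset.sum_smul, this, one_smul]
    · simp [image_eq_zero_of_notMem_tsupport hx]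
  have hF : ∀ i : t, IsTestField (V i) (fun x => ρ i x • φ x) := fun i => by
    refine IsField.isTestField ⟨(hρC i).smul hφ.contDiff, (hφ.isField.smul (hρC i)).2,
      (tsupport_smul_field_subset_left _ φ).trans (hρ i)⟩ fun x => ?_
    rw [norm_smul, Real.norm_of_nonneg (ρ.nonneg i x)]
    exact mul_le_one₀ (ρ.le_one i x) (norm_nonneg _) (hφ.norm_le_one x)
  calc ENNReal.ofReal (pairing f φ)
      = ENNReal.ofReal (∑ i : t, pairing f (fun x => ρ i x • φ x)) := by
        conv_lhs => rw [hsum]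
        rw [pairing_sum hf _ fun i _ => (hF i).isField.mono (hVΩ i)]
    _ ≤ ∑ i : t, ENNReal.ofReal (pairing f (fun x => ρ i x • φ x)) :=
        Finset.le_sum_of_subadditive _ ENNReal.ofReal_zero.le (fun _ _ => ENNReal.ofReal_add_le) _ _
    _ ≤ ∑ i : t, variation f (V i) :=
        Finset.sum_le_sum fun i _ => ofReal_pairing_le_variation f (hF i)
    _ = ∑ i ∈ t, variation f (V i) := Finset.sum_coe_sort t fun i => variation f (V i)
    _ ≤ ∑' i, variation f (V i) := ENNReal.sum_le_tsum t

theorem norm_add_le_one_of_disjoint {n : ℕ} {φ ψ : Rn n → Rn n} (hφ : ∀ x, ‖φ x‖ ≤ 1)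
    (hψ : ∀ x, ‖ψ x‖ ≤ 1) (hd : Disjoint (tsupport φ) (tsupport ψ)) (x : Rn n) :
    ‖φ x + ψ x‖ ≤ 1 := by
  by_cases hx : x ∈ tsupport φ
  · simpa [image_eq_zero_of_notMem_tsupport fun h => Set.disjoint_left.1 hd hx h] using hφ x
  · simpa [image_eq_zero_of_notMem_tsupport hx] using hψ x

theorem ofReal_pairing_add_variation_le {n : ℕ} {f : Rn n → ℝ} {Ω V W : Set (Rn n)}
    (hf : LocallyIntegrableOn f Ω) (hV : V ⊆ Ω) (hW : W ⊆ V) {φ : Rn n → Rn n}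
    (hφ : IsTestField V φ) (hd : Disjoint (tsupport φ) W) :
    ENNReal.ofReal (pairing f φ) + variation f W ≤ variation f V := by
  rcases le_or_gt (pairing f φ) 0 with h0 | h0
  · simpa [ENNReal.ofReal_of_nonpos h0] using variation_mono f hW
  rw [variation_eq_iSup_pairing f W, ENNReal.add_iSup]
  refine iSup_le fun ψ => ?_
  by_cases hψ : IsTestField W ψ
  · simp only [hψ, iSup_pos]
    have h1 : IsTestField V (fun x => φ x + ψ x) :=
      (hφ.isField.add (hψ.isField.mono hW)).isTestField (norm_add_le_one_of_disjoint
        hφ.norm_le_one hψ.norm_le_one (hd.mono_right hψ.tsupport_subset))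
    have h2 := ofReal_pairing_le_variation f h1
    rw [pairing_add hf (hφ.isField.mono hV) (hψ.isField.mono (hW.trans hV))] at h2
    rcases le_or_gt (pairing f ψ) 0 with h3 | h3
    · rw [ENNReal.ofReal_of_nonpos h3, add_zero]
      exact ofReal_pairing_le_variation f hφ
    · rwa [ENNReal.ofReal_add h0.le h3.le] at h2
  · simp only [hψ, iSup_false, bot_eq_zero, add_zero]
    exact ofReal_pairing_le_variation f hφ

/-! ### The outer measure generated by the variation -/

/-- The outer measure generated by `U ↦ |Df|(U ∩ Ω)` on the open sets. -/
def outerVariation {n : ℕ} (f : Rn n → ℝ) (Ω : Set (Rn n)) : OuterMeasure (Rn n) :=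
  inducedOuterMeasure (P := IsOpen) (fun U _ => variation f (U ∩ Ω)) isOpen_empty
    (variation_empty_inter f Ω)

theorem totalVariation_apply {n : ℕ} (f : Rn n → ℝ) (Ω A : Set (Rn n)) :
    totalVariation f Ω A = outerVariation f Ω (A ∩ Ω) := by
  simp [totalVariation, outerVariation]

theorem outerVariation_of_isOpen {n : ℕ} {f : Rn n → ℝ} {Ω U : Set (Rn n)} (hΩ : IsOpen Ω)
    (hf : LocallyIntegrableOn f Ω) (hU : IsOpen U) :
    outerVariation f Ω U = variation f (U ∩ Ω) := by
  refine inducedOuterMeasure_eq' (P := IsOpen) (fun V hV => isOpen_iUnion hV) ?_ ?_ hU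
  · intro V hV
    rw [Set.iUnion_inter]
    exact variation_iUnion_le hf (fun i => (hV i).inter hΩ) fun i => Set.inter_subset_right
  · intro V W _ _ hVW
    exact variation_mono f (Set.inter_subset_inter_left Ω hVW)

theorem outerVariation_of_isOpen_subset {n : ℕ} {f : Rn n → ℝ} {Ω U : Set (Rn n)}
    (hΩ : IsOpen Ω) (hf : LocallyIntegrableOn f Ω) (hU : IsOpen U) (hUΩ : U ⊆ Ω) :
    outerVariation f Ω U = variation f U := by
  rw [outerVariation_of_isOpen hΩ hf hU, Set.inter_eq_left.2 hUΩ]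

theorem exists_isOpen_variation_lt {n : ℕ} {f : Rn n → ℝ} {Ω W A : Set (Rn n)} (hΩ : IsOpen Ω)
    (hf : LocallyIntegrableOn f Ω) (hW : IsOpen W) (hWΩ : W ⊆ Ω) (hAW : A ⊆ W)
    (hA : outerVariation f Ω A ≠ ∞) {ε : ℝ≥0∞} (hε : ε ≠ 0) :
    ∃ V, IsOpen V ∧ A ⊆ V ∧ V ⊆ W ∧ variation f V < outerVariation f Ω A + ε := by
  have h := ENNReal.lt_add_right hA hε
  conv_lhs at h =>
    rw [outerVariation, inducedOuterMeasure_eq_iInf (P := IsOpen) (fun V hV => isOpen_iUnion hV)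
      (fun V hV => by
        rw [Set.iUnion_inter]
        exact variation_iUnion_le hf (fun i => (hV i).inter hΩ) fun i => Set.inter_subset_right)
      (fun V W _ _ hVW => variation_mono f (Set.inter_subset_inter_left Ω hVW))]
  simp only [iInf_lt_iff] at h
  obtain ⟨V, hV, hAV, h⟩ := h
  exact ⟨V ∩ W, hV.inter hW, Set.subset_inter hAV hAW, Set.inter_subset_right,
    (variation_mono f (Set.inter_subset_inter_right V hWΩ)).trans_lt h⟩

/-- Each test field of `O` has compact support, whose complement in `V` is open and contains `V \
O`; on that open set the outer measure is again a supremum over fields, whose supports are disjoint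
from the first one. This additivity replaces any appeal to Carathéodory measurability. -/
theorem variation_add_outerVariation_diff_le {n : ℕ} {f : Rn n → ℝ} {Ω V O : Set (Rn n)}
    (hΩ : IsOpen Ω) (hf : LocallyIntegrableOn f Ω) (hV : IsOpen V) (hVΩ : V ⊆ Ω)
    (hOV : O ⊆ V) :
    variation f O + outerVariation f Ω (V \ O) ≤ variation f V := by
  rw [variation_eq_iSup_pairing f O, ENNReal.iSup_add]
  have key : ∀ φ, IsTestField O φ → ENNReal.ofReal (pairing f φ) + outerVariation f Ω (V \ O)
      ≤ variation f V := by
    intro φ hφ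
    have hopen : IsOpen (V \ tsupport φ) := hV.sdiff (isClosed_tsupport φ)
    calc ENNReal.ofReal (pairing f φ) + outerVariation f Ω (V \ O)
        ≤ ENNReal.ofReal (pairing f φ) + outerVariation f Ω (V \ tsupport φ) := by
          gcongr
          exact hφ.tsupport_subset
      _ = ENNReal.ofReal (pairing f φ) + variation f (V \ tsupport φ) := by
          rw [outerVariation_of_isOpen_subset hΩ hf hopen (Set.sdiff_subset.trans hVΩ)]
      _ ≤ variation f V := ofReal_pairing_add_variation_le hf hVΩ Set.sdiff_subset
          (hφ.mono hOV) Set.disjoint_sdiff_right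
  refine iSup_le fun φ => ?_
  by_cases hφ : IsTestField O φ
  · simpa [hφ] using key φ hφ
  · simpa [hφ, pairing_zero] using key _ (IsTestField.zero O)

/-! ### A covering theorem for convex sets of bounded eccentricity -/

theorem exists_packing_bound (E : Type*) [NormedAddCommGroup E] [ProperSpace E]
    (R : ℝ) {δ : ℝ} (hδ : 0 < δ) :
    ∃ N : ℕ, ∀ (ι : Type _) (F : Finset ι) (p : ι → E), (∀ i ∈ F, ‖p i‖ ≤ R) →
      (∀ i ∈ F, ∀ j ∈ F, i ≠ j → δ ≤ ‖p i - p j‖) → F.card ≤ N := by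
  obtain ⟨t, ht, hcov⟩ := Metric.totallyBounded_iff.1
    (isCompact_closedBall (0 : E) R).totallyBounded (δ / 2) (by positivity)
  refine ⟨ht.toFinset.card, fun ι F p hR hsep => ?_⟩
  have hex : ∀ i ∈ F, ∃ y ∈ t, p i ∈ Metric.ball y (δ / 2) := fun i hi => by
    simpa using hcov (mem_closedBall_zero_iff.2 (hR i hi))
  choose! c hct hc using hex
  refine Finset.card_le_card_of_injOn c (fun i hi => by simpa using hct i hi) ?_
  intro i hi j hj hij
  by_contra hne
  have h1 := hc i hi
  have h2 := hc j hj
  rw [← hij] at h2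
  have h3 := dist_triangle_right (p i) (p j) (c i)
  rw [Metric.mem_ball] at h1 h2
  have h4 := hsep i hi j hj hne
  rw [dist_eq_norm] at h3
  linarith

/-- `C` is a convex set with `B(a, r) ⊆ C ⊆ B(a, λr)`. -/
structure IsRoundConvex {E : Type*} [NormedAddCommGroup E] [NormedSpace ℝ E] (l : ℝ) (C : Set E)
    (a : E) (r : ℝ) : Prop where
  convex : Convex ℝ C
  pos : 0 < r
  ball_subset : Metric.ball a r ⊆ C
  subset_closedBall : C ⊆ Metric.closedBall a (l * r)

/-- Seen from `z`, the points `a` and `b` lie in nearly the same direction. By convexity `C`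
contains the segment from `z` towards `b` up to length `‖a - z‖`, so a point `b` outside `C` cannot
be close to `z`. -/
theorem IsRoundConvex.le_norm_sub_of_notMem {E : Type*} [NormedAddCommGroup E] [NormedSpace ℝ E]
    {l : ℝ} (hl : 1 ≤ l) {C : Set E} {a : E} {r : ℝ} (h : IsRoundConvex l C a r) {z b : E}
    (hz : z ∈ C) (hb : b ∉ C)
    (hdir : ‖‖b - z‖⁻¹ • (b - z) - ‖a - z‖⁻¹ • (a - z)‖ ≤ 1 / (2 * l)) :
    r / 2 ≤ ‖b - z‖ := by
  by_contra! hlt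
  have hr := h.pos
  have hid : ∀ v : E, ‖v‖ • (‖v‖⁻¹ • v) = v := fun v => by
    rcases eq_or_ne v 0 with rfl | hv
    · simp
    · rw [smul_smul, mul_inv_cancel₀ (norm_ne_zero_iff.2 hv), one_smul]
  rcases lt_or_ge ‖a - z‖ (r / 2) with hs | hs
  · refine hb (h.ball_subset ?_)
    rw [Metric.mem_ball, dist_eq_norm]
    calc ‖b - a‖ = ‖(b - z) - (a - z)‖ := by congr 1; abel
      _ ≤ ‖b - z‖ + ‖a - z‖ := norm_sub_le _ _
      _ < r := by linarith
  · set s := ‖a - z‖ with hsdef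
    have hs0 : 0 < s := by linarith
    have hsl : s ≤ l * r := by
      have := h.subset_closedBall hz
      rwa [Metric.mem_closedBall, dist_comm, dist_eq_norm] at this
    set e := ‖b - z‖⁻¹ • (b - z) with he
    -- Going from `z` the distance to `a`, but in the direction of `b`, misses `a` by at most `s /
    -- (2l) ≤ r / 2`.
    have hp : z + s • e ∈ C := by
      refine h.ball_subset ?_
      rw [Metric.mem_ball, dist_eq_norm]
      have : z + s • e - a = s • (e - s⁻¹ • (a - z)) := by
        rw [smul_sub, hid (a - z)]
        abel
      rw [this, norm_smul, Real.norm_of_nonneg hs0.le]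
      calc s * ‖e - s⁻¹ • (a - z)‖ ≤ (l * r) * (1 / (2 * l)) := by gcongr
        _ = r / 2 := by field_simp
        _ < r := by linarith
    have hbz : b = (1 - ‖b - z‖ / s) • z + (‖b - z‖ / s) • (z + s • e) := by
      rw [smul_add, smul_smul, div_mul_cancel₀ _ hs0.ne', he, hid, sub_smul, one_smul]
      abel
    refine hb ?_
    rw [hbz]
    have h1 : ‖b - z‖ / s ≤ 1 := (div_le_one hs0).2 (by linarith)
    exact h.convex hz hp (by linarith) (by positivity) (by ring)

theorem IsRoundConvex.radius_le_of_notMem {E : Type*} [NormedAddCommGroup E] [NormedSpace ℝ E]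
    {l : ℝ} (hl : 1 ≤ l) {C D : Set E} {a b : E} {r s : ℝ} (h : IsRoundConvex l C a r)
    (h' : IsRoundConvex l D b s) {z : E} (hz : z ∈ C) (hz' : z ∈ D) (hb : b ∉ C)
    (hdir : ‖‖b - z‖⁻¹ • (b - z) - ‖a - z‖⁻¹ • (a - z)‖ ≤ 1 / (2 * l)) :
    r ≤ 2 * l * s := by
  have h1 := h.le_norm_sub_of_notMem hl hz hb hdir
  have h2 := h'.subset_closedBall hz'
  rw [Metric.mem_closedBall, dist_comm, dist_eq_norm] at h2
  linarith

/-- The centres are sorted into finitely many classes by their direction from `z`. Within a class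
all radii are comparable up to the factor `2l`, so after scaling the centres form a separated
bounded set, whose size is limited by compactness. -/
theorem exists_overlap_bound (E : Type*) [NormedAddCommGroup E] [NormedSpace ℝ E] [ProperSpace E]
    {l : ℝ} (hl : 1 ≤ l) :
    ∃ N : ℕ, ∀ (F : Finset E) (C : E → Set E) (r : E → ℝ) (z : E),
      (∀ a ∈ F, IsRoundConvex l (C a) a (r a)) → (∀ a ∈ F, z ∈ C a) →
      (∀ a ∈ F, ∀ b ∈ F, a ≠ b → (b ∉ C a ∧ r b ≤ 2 * r a) ∨ (a ∉ C b ∧ r a ≤ 2 * r b)) →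
      F.card ≤ N := by
  classical
  have hl0 : 0 < l := by linarith
  obtain ⟨t, ht, hcov⟩ := Metric.totallyBounded_iff.1
    (isCompact_closedBall (0 : E) 1).totallyBounded (1 / (4 * l)) (by positivity)
  -- In units of the radius of one member of a class, the others have radius between `1 / (2l)` and
  -- `2l`: they are centred within `l * (2l)` of `z`, at mutual distance at least `1 / (2l)`.
  obtain ⟨N, hN⟩ := exists_packing_bound E (l * (2 * l)) (δ := 1 / (2 * l)) (by positivity)
  refine ⟨N * ht.toFinset.card, fun F C r z hC hz hF => ?_⟩
  set dir : E → E := fun a => ‖a - z‖⁻¹ • (a - z) with hdir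
  have hdir1 : ∀ a, ‖dir a‖ ≤ 1 := fun a => by
    rw [hdir, norm_smul, norm_inv, norm_norm]
    exact inv_mul_le_one
  have hex : ∀ a, ∃ y ∈ t, dir a ∈ Metric.ball y (1 / (4 * l)) := fun a => by
    simpa using hcov (mem_closedBall_zero_iff.2 (hdir1 a))
  choose c hct hc using hex
  refine Finset.card_le_mul_card_image_of_maps_to (f := c) (fun a _ => by simpa using hct a) N ?_
  intro y _
  set G := F.filter fun a => c a = y with hG
  have hclose : ∀ a ∈ G, ∀ b ∈ G, ‖dir b - dir a‖ ≤ 1 / (2 * l) := by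
    intro a ha b hb
    have h1 := hc a
    have h2 := hc b
    rw [(Finset.mem_filter.1 ha).2] at h1
    rw [(Finset.mem_filter.1 hb).2] at h2
    have h3 := dist_triangle_right (dir b) (dir a) y
    rw [Metric.mem_ball] at h1 h2
    rw [dist_eq_norm] at h3
    have : 1 / (2 * l) = 1 / (4 * l) + 1 / (4 * l) := by field_simp; norm_num
    linarith
  have hGF : ∀ a ∈ G, a ∈ F := fun a ha => (Finset.mem_filter.1 ha).1
  have hratio : ∀ a ∈ G, ∀ b ∈ G, r a ≤ 2 * l * r b := by
    intro a ha b hb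
    have hb0 := (hC b (hGF b hb)).pos
    rcases eq_or_ne a b with rfl | hab
    · nlinarith
    rcases hF a (hGF a ha) b (hGF b hb) hab with ⟨h1, -⟩ | ⟨-, h2⟩
    · exact (hC a (hGF a ha)).radius_le_of_notMem hl (hC b (hGF b hb)) (hz a (hGF a ha))
        (hz b (hGF b hb)) h1 (hclose a ha b hb)
    · nlinarith
  rcases G.eq_empty_or_nonempty with hGe | ⟨a₀, ha₀⟩
  · simp [hGe]
  have hr0 := (hC a₀ (hGF a₀ ha₀)).pos
  refine hN E G (fun a => (r a₀)⁻¹ • (a - z)) (fun a ha => ?_) fun a ha b hb hab => ?_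
  · rw [norm_smul, norm_inv, Real.norm_of_nonneg hr0.le, inv_mul_le_iff₀ hr0]
    have h2 := (hC a (hGF a ha)).subset_closedBall (hz a (hGF a ha))
    rw [Metric.mem_closedBall, dist_comm, dist_eq_norm] at h2
    have h3 := hratio a ha a₀ ha₀
    calc ‖a - z‖ ≤ l * r a := h2
      _ ≤ l * (2 * l * r a₀) := by gcongr
      _ = r a₀ * (l * (2 * l)) := by ring
  · rw [← smul_sub, norm_smul, norm_inv, Real.norm_of_nonneg hr0.le, sub_sub_sub_cancel_right,
      le_inv_mul_iff₀ hr0, mul_one_div, div_le_iff₀ (by positivity)]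
    have hsep : ∀ a ∈ G, ∀ b, b ∉ C a → r a₀ ≤ ‖a - b‖ * (2 * l) := by
      intro a ha b h
      have h1 : r a ≤ ‖a - b‖ := by
        by_contra! h2
        refine h ((hC a (hGF a ha)).ball_subset ?_)
        rwa [Metric.mem_ball, dist_comm, dist_eq_norm]
      have h3 := hratio a₀ ha₀ a ha
      nlinarith
    rcases hF a (hGF a ha) b (hGF b hb) hab with ⟨h1, -⟩ | ⟨h1, -⟩
    · exact hsep a ha b h1
    · rw [norm_sub_rev]
      exact hsep b hb a h1

/-- Greedy selection, largest sets first. Radii are compared only through their dyadic scale, which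
makes the order well-founded without attaining any supremum and costs the factor `2`. -/
theorem exists_subfamily_covering {E : Type*} (A : Set E) (C : E → Set E) (r : E → ℝ)
    (hr : ∀ a ∈ A, 0 < r a ∧ r a ≤ 1) (hC : ∀ a ∈ A, a ∈ C a) :
    ∃ S ⊆ A, A ⊆ ⋃ a ∈ S, C a ∧
      ∀ a ∈ S, ∀ b ∈ S, a ≠ b → (b ∉ C a ∧ r b ≤ 2 * r a) ∨ (a ∉ C b ∧ r a ≤ 2 * r b) := by
  have hk : ∀ a ∈ A, ∃ k : ℕ, (1 / 2 : ℝ) ^ (k + 1) < r a ∧ r a ≤ (1 / 2 : ℝ) ^ k := fun a ha =>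
    exists_nat_pow_near_of_lt_one (hr a ha).1 (hr a ha).2 (by norm_num) (by norm_num)
  choose! k hk1 hk2 using hk
  set R : E → E → Prop := InvImage (Prod.Lex (· < ·) WellOrderingRel) fun a => (k a, a) with hR
  have hwf : WellFounded R :=
    InvImage.wf _ (WellFounded.prod_lex wellFounded_lt WellOrderingRel.isWellOrder.wf)
  have hRk : ∀ a b, R a b → k a ≤ k b := fun a b h => by
    rcases (Prod.lex_def.1 h) with h | h
    · exact h.le
    · exact h.1.le
  have htri : ∀ a b, a ≠ b → R a b ∨ R b a := fun a b hab => by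
    simp only [hR, InvImage, Prod.lex_def]
    rcases lt_trichotomy (k a) (k b) with h | h | h
    · simp [h]
    · rcases trichotomous_of WellOrderingRel a b with h' | h' | h'
      · simp [h, h']
      · exact absurd h' hab
      · simp [h, h']
    · simp [h]
  have hRr : ∀ a ∈ A, ∀ b ∈ A, R a b → r b ≤ 2 * r a := fun a ha b hb h => by
    have h1 : (1 / 2 : ℝ) ^ k b ≤ (1 / 2 : ℝ) ^ k a :=
      pow_le_pow_of_le_one (by norm_num) (by norm_num) (hRk a b h)
    have h2 := hk1 a ha
    have h3 := hk2 b hb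
    rw [pow_succ] at h2
    linarith
  -- A point is selected exactly when no previously selected set already covers it.
  set P : E → Prop := hwf.fix fun b ih => b ∈ A ∧ ∀ (a : E) (h : R a b), ih a h → b ∉ C a with hP
  have hPeq : ∀ b, P b ↔ (b ∈ A ∧ ∀ a, R a b → P a → b ∉ C a) := fun b => by
    rw [hP, hwf.fix_eq]
  refine ⟨{a | P a}, fun a ha => ((hPeq a).1 ha).1, fun a ha => ?_, fun a ha b hb hab => ?_⟩
  · by_cases h : P a
    · exact Set.mem_biUnion (show a ∈ {a | P a} from h) (hC a ha)
    · rw [hPeq] at h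
      push Not at h
      obtain ⟨b, -, hb, hab⟩ := h ha
      exact Set.mem_biUnion (show b ∈ {a | P a} from hb) hab
  · have ha' := (hPeq a).1 ha
    have hb' := (hPeq b).1 hb
    rcases htri a b hab with h | h
    · exact Or.inl ⟨hb'.2 a h ha, hRr a ha'.1 b hb'.1 h⟩
    · exact Or.inr ⟨ha'.2 b h hb, hRr b hb'.1 a ha'.1 h⟩

/-- The Morse covering theorem for families of open convex sets of bounded eccentricity. -/
theorem exists_countable_covering_bounded_overlap (E : Type*) [NormedAddCommGroup E]
    [NormedSpace ℝ E] [ProperSpace E] {l : ℝ} (hl : 1 ≤ l) :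
    ∃ N : ℕ, ∀ (A : Set E) (C : E → Set E) (r : E → ℝ),
      (∀ a ∈ A, IsRoundConvex l (C a) a (r a)) → (∀ a ∈ A, r a ≤ 1) → (∀ a ∈ A, IsOpen (C a)) →
      ∃ S ⊆ A, S.Countable ∧ A ⊆ ⋃ a ∈ S, C a ∧
        ∀ (z : E) (F : Finset E), ↑F ⊆ S → (∀ a ∈ F, z ∈ C a) → F.card ≤ N := by
  obtain ⟨N, hN⟩ := exists_overlap_bound E hl
  refine ⟨N, fun A C r hC hr ho => ?_⟩
  have hmem : ∀ a ∈ A, a ∈ C a := fun a ha =>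
    (hC a ha).ball_subset (Metric.mem_ball_self (hC a ha).pos)
  obtain ⟨S, hSA, hcov, hS⟩ := exists_subfamily_covering A C r
    (fun a ha => ⟨(hC a ha).pos, hr a ha⟩) hmem
  have hover : ∀ (z : E) (F : Finset E), ↑F ⊆ S → (∀ a ∈ F, z ∈ C a) → F.card ≤ N :=
    fun z F hF hz => hN F C r z (fun a ha => hC a (hSA (hF ha))) hz
      fun a ha b hb => hS a (hF ha) b (hF hb)
  refine ⟨S, hSA, ?_, hcov, hover⟩
  have : Nonempty E := ⟨0⟩
  -- Each selected set is open and nonempty, hence contains a point of a countable dense set, while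
  -- every point lies in at most `N` selected sets.
  have hSsub : S ⊆ ⋃ k : ℕ, {a ∈ S | TopologicalSpace.denseSeq E k ∈ C a} := fun a ha => by
    obtain ⟨k, hk⟩ := (TopologicalSpace.denseRange_denseSeq E).exists_mem_open (ho a (hSA ha))
      ⟨a, hmem a (hSA ha)⟩
    exact Set.mem_iUnion.2 ⟨k, ha, hk⟩
  refine (Set.countable_iUnion fun k => Set.Finite.countable ?_).mono hSsub
  by_contra hinf
  obtain ⟨F, hF, hcard⟩ := Set.Infinite.exists_subset_card_eq hinf (N + 1)
  have := hover (TopologicalSpace.denseSeq E k) F (fun a ha => (hF ha).1) fun a ha => (hF ha).2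
  omega

/-! ### The unit cube -/

theorem isOpen_unitCube (n : ℕ) : IsOpen (unitCube n) := by
  simp only [unitCube, Set.ofPred_forall]
  exact isOpen_iInter_of_finite fun i => isOpen_lt (by fun_prop) continuous_const

theorem convex_unitCube (n : ℕ) : Convex ℝ (unitCube n) := by
  intro x hx y hy a b ha hb hab i
  have h1 := abs_lt.1 (hx i)
  have h2 := abs_lt.1 (hy i)
  simp only [PiLp.add_apply, PiLp.smul_apply, smul_eq_mul]
  rw [abs_lt]
  rcases ha.eq_or_lt with rfl | ha
  · obtain rfl : b = 1 := by linarith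
    constructor <;> linarith
  · constructor <;> nlinarith

theorem zero_mem_unitCube (n : ℕ) : (0 : Rn n) ∈ unitCube n := fun i => by simp

theorem norm_le_of_mem_unitCube {n : ℕ} {y : Rn n} (hy : y ∈ unitCube n) : ‖y‖ ≤ n := by
  calc ‖y‖ = √(∑ i, ‖y i‖ ^ 2) := EuclideanSpace.norm_eq y
    _ ≤ √(∑ _i : Fin n, 1) := by
      refine Real.sqrt_le_sqrt (Finset.sum_le_sum fun i _ => ?_)
      have := hy i
      rw [Real.norm_eq_abs]
      exact pow_le_one₀ (abs_nonneg _) (by linarith)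
    _ = √n := by simp
    _ ≤ n := by
      rw [Real.sqrt_le_left (by positivity)]
      exact_mod_cast Nat.le_self_pow two_ne_zero n

theorem measurableSet_unitCube (n : ℕ) : MeasurableSet (unitCube n) :=
  (isOpen_unitCube n).measurableSet

theorem volume_unitCube_lt_top (n : ℕ) : volume (unitCube n) < ∞ :=
  (Metric.isBounded_iff_subset_closedBall 0 |>.2 ⟨n, fun _ hy =>
    mem_closedBall_zero_iff.2 (norm_le_of_mem_unitCube hy)⟩).measure_lt_top

theorem volume_unitCube_pos (n : ℕ) : 0 < volume (unitCube n) :=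
  (isOpen_unitCube n).measure_pos volume ⟨0, zero_mem_unitCube n⟩

theorem abs_apply_le_norm {n : ℕ} (y : Rn n) (i : Fin n) : |y i| ≤ ‖y‖ :=
  PiLp.norm_apply_le y i

theorem smul_mem_unitCube {n : ℕ} {y : Rn n} (hy : y ∈ unitCube n) {t : ℝ} (h0 : 0 ≤ t)
    (h1 : t ≤ 1) : t • y ∈ unitCube n := by
  simpa using (convex_unitCube n) hy (zero_mem_unitCube n) h0 (sub_nonneg.2 h1) (by ring)

theorem smul_add_mem_unitCube {n : ℕ} {y w : Rn n} (hy : y ∈ unitCube n) {t : ℝ} (h0 : 0 ≤ t)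
    (hw : ‖w‖ < (1 - t) / 2) : w + t • y ∈ unitCube n := fun i => by
  have h1 := hy i
  have h2 := abs_apply_le_norm w i
  simp only [PiLp.add_apply, PiLp.smul_apply, smul_eq_mul]
  calc |w i + t * y i| ≤ |w i| + |t * y i| := abs_add_le _ _
    _ = |w i| + t * |y i| := by rw [abs_mul, abs_of_nonneg h0]
    _ < 1 / 2 := by nlinarith

namespace OrientedCube

/-! ### The similarity of an oriented cube -/

/-- The inverse of the similarity `T_Q`. -/
def invMap {n : ℕ} (Q : OrientedCube n) (x : Rn n) : Rn n :=
  Q.frame.symm (Q.side⁻¹ • (x - Q.center))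

@[simp] theorem map_invMap {n : ℕ} (Q : OrientedCube n) (x : Rn n) : Q.map (Q.invMap x) = x := by
  simp [map, invMap, smul_smul, Q.side_pos.ne']

@[simp] theorem invMap_map {n : ℕ} (Q : OrientedCube n) (y : Rn n) : Q.invMap (Q.map y) = y := by
  simp [map, invMap, smul_smul, Q.side_pos.ne']

/-- The similarity `T_Q` as a homeomorphism of `ℝⁿ`. -/
def homeomorph {n : ℕ} (Q : OrientedCube n) : Rn n ≃ₜ Rn n where
  toFun := Q.map
  invFun := Q.invMap
  left_inv := Q.invMap_map
  right_inv := Q.map_invMap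
  continuous_toFun := by unfold map; fun_prop
  continuous_invFun := by unfold invMap; fun_prop

theorem continuous_map {n : ℕ} (Q : OrientedCube n) : Continuous Q.map :=
  Q.homeomorph.continuous

theorem map_injective {n : ℕ} (Q : OrientedCube n) : Function.Injective Q.map :=
  Q.homeomorph.injective

theorem map_surjective {n : ℕ} (Q : OrientedCube n) : Function.Surjective Q.map :=
  Q.homeomorph.surjective

theorem isOpen_map_image {n : ℕ} (Q : OrientedCube n) {U : Set (Rn n)} (hU : IsOpen U) :
    IsOpen (Q.map '' U) :=
  Q.homeomorph.isOpenMap U hU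

theorem isOpen_carrier {n : ℕ} (Q : OrientedCube n) : IsOpen Q.carrier :=
  Q.isOpen_map_image (isOpen_unitCube n)

theorem dist_map {n : ℕ} (Q : OrientedCube n) (y z : Rn n) :
    dist (Q.map y) (Q.map z) = Q.side * dist y z := by
  simp only [map, dist_add_left, dist_smul₀, Q.frame.dist_map]
  rw [Real.norm_of_nonneg Q.side_pos.le]

/-- The image of the oriented cube `P` under the similarity of `Q`. -/
def comp {n : ℕ} (Q P : OrientedCube n) : OrientedCube n where
  center := Q.map P.center
  side := Q.side * P.side
  side_pos := mul_pos Q.side_pos P.side_pos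
  frame := P.frame.trans Q.frame

theorem comp_map {n : ℕ} (Q P : OrientedCube n) (y : Rn n) :
    (Q.comp P).map y = Q.map (P.map y) := by
  simp [comp, map, smul_smul, add_assoc]

theorem comp_carrier {n : ℕ} (Q P : OrientedCube n) :
    (Q.comp P).carrier = Q.map '' P.carrier := by
  simp only [carrier, Set.image_image, comp_map]

theorem comp_carrier_subset {n : ℕ} (Q : OrientedCube n) {P : OrientedCube n}
    (hP : P.carrier ⊆ unitCube n) : (Q.comp P).carrier ⊆ Q.carrier := by
  rw [comp_carrier]
  exact Set.image_mono hP

theorem map_mem_comp_contraction {n : ℕ} {τ : ℝ} (Q : OrientedCube n) {P : OrientedCube n}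
    {y : Rn n} (hy : y ∈ P.contraction τ) : Q.map y ∈ (Q.comp P).contraction τ := by
  obtain ⟨z, hz, rfl⟩ := hy
  exact ⟨z, hz, comp_map Q P _⟩

theorem contraction_subset_carrier {n : ℕ} {τ : ℝ} (h0 : 0 ≤ τ) (h1 : τ < 1)
    (Q : OrientedCube n) : Q.contraction τ ⊆ Q.carrier := by
  rintro _ ⟨z, hz, rfl⟩
  exact ⟨τ • z, smul_mem_unitCube hz h0 h1.le, rfl⟩

theorem convex_carrier {n : ℕ} (Q : OrientedCube n) : Convex ℝ Q.carrier := by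
  have : Q.carrier = (fun x => Q.center + x) '' ((fun x => Q.side • x) ''
      (Q.frame.toLinearEquiv.toLinearMap '' unitCube n)) := by
    simp only [carrier, Set.image_image]
    rfl
  rw [this]
  exact (((convex_unitCube n).linear_image _).smul _).translate _

/-- A point of `τQ` keeps the distance `(1 - τ) ℓ(Q) / 2` from the complement of `Q`. Here `τ < 1`
makes the eccentricity bounded, so that the Morse covering theorem applies to cubes that are not
centred at `a`. -/
theorem isRoundConvex {n : ℕ} {τ : ℝ} (h0 : 0 ≤ τ) (h1 : τ < 1) (Q : OrientedCube n) {a : Rn n}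
    (ha : a ∈ Q.contraction τ) :
    IsRoundConvex (4 * (n + 1) / (1 - τ)) Q.carrier a ((1 - τ) / 2 * Q.side) where
  convex := Q.convex_carrier
  pos := mul_pos (by linarith) Q.side_pos
  ball_subset := by
    obtain ⟨z, hz, rfl⟩ := ha
    intro x hx
    obtain ⟨y, rfl⟩ := Q.map_surjective x
    rw [Metric.mem_ball, dist_map, mul_comm, mul_lt_mul_iff_left₀ Q.side_pos, dist_eq_norm] at hx
    refine ⟨y, ?_, rfl⟩
    simpa using smul_add_mem_unitCube hz h0 hx
  subset_closedBall := by
    obtain ⟨y, hy, rfl⟩ := contraction_subset_carrier h0 h1 Q ha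
    rintro _ ⟨z, hz, rfl⟩
    have h2 : 0 < 1 - τ := by linarith
    rw [Metric.mem_closedBall, dist_map]
    have h3 : dist z y ≤ 2 * (n + 1) := by
      rw [dist_eq_norm]
      have := norm_sub_le z y
      have := norm_le_of_mem_unitCube hz
      have := norm_le_of_mem_unitCube hy
      linarith
    calc Q.side * dist z y ≤ Q.side * (2 * (n + 1)) := by
          have := Q.side_pos
          gcongr
      _ = 4 * (n + 1) / (1 - τ) * ((1 - τ) / 2 * Q.side) := by field_simp; norm_num

theorem one_le_roundness {n : ℕ} {τ : ℝ} (h0 : 0 ≤ τ) (h1 : τ < 1) :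
    1 ≤ 4 * ((n : ℝ) + 1) / (1 - τ) := by
  rw [le_div_iff₀ (by linarith)]
  have : (0 : ℝ) ≤ n := Nat.cast_nonneg n
  linarith

/-! ### Change of variables -/

theorem hasFDerivAt_map {n : ℕ} (Q : OrientedCube n) (y : Rn n) :
    HasFDerivAt Q.map (Q.side • (Q.frame : Rn n →L[ℝ] Rn n)) y := by
  unfold map
  exact ((Q.frame : Rn n →L[ℝ] Rn n).hasFDerivAt.const_smul Q.side).const_add Q.center

theorem abs_det_frame {n : ℕ} (Q : OrientedCube n) :
    |(Q.side • (Q.frame : Rn n →L[ℝ] Rn n)).det| = Q.side ^ n := by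
  have h1 := Q.frame.toLinearIsometry.normDet_eq_one
  have h2 : |LinearMap.det (Q.frame.toLinearIsometry.toLinearMap)| = 1 := by
    rw [← LinearMap.normDet_eq_abs_det, h1]
  have h3 : (Q.side • (Q.frame : Rn n →L[ℝ] Rn n)).det
      = LinearMap.det (Q.side • Q.frame.toLinearIsometry.toLinearMap) := rfl
  rw [h3, LinearMap.det_smul, abs_mul, h2, finrank_euclideanSpace_fin, mul_one,
    abs_of_pos (pow_pos Q.side_pos n)]

theorem lintegral_map_image {n : ℕ} (Q : OrientedCube n) {S : Set (Rn n)} (hS : MeasurableSet S)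
    (g : Rn n → ℝ≥0∞) :
    ∫⁻ x in Q.map '' S, g x = ENNReal.ofReal (Q.side ^ n) * ∫⁻ y in S, g (Q.map y) := by
  rw [lintegral_image_eq_lintegral_abs_det_fderiv_mul volume hS
    (fun x _ => (Q.hasFDerivAt_map x).hasFDerivWithinAt) Q.map_injective.injOn]
  simp only [abs_det_frame]
  rw [lintegral_const_mul' _ _ ENNReal.ofReal_ne_top]

theorem integral_map_image {n : ℕ} (Q : OrientedCube n) {S : Set (Rn n)} (hS : MeasurableSet S)
    (g : Rn n → ℝ) :
    ∫ x in Q.map '' S, g x = Q.side ^ n * ∫ y in S, g (Q.map y) := by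
  rw [integral_image_eq_integral_abs_det_fderiv_smul volume hS
    (fun x _ => (Q.hasFDerivAt_map x).hasFDerivWithinAt) Q.map_injective.injOn]
  simp only [abs_det_frame, smul_eq_mul]
  rw [integral_const_mul]

theorem integrableOn_map_image_iff {n : ℕ} (Q : OrientedCube n) {S : Set (Rn n)}
    (hS : MeasurableSet S) (g : Rn n → ℝ) :
    IntegrableOn g (Q.map '' S) ↔ IntegrableOn (fun y => g (Q.map y)) S := by
  rw [integrableOn_image_iff_integrableOn_abs_det_fderiv_smul volume hS
    (fun x _ => (Q.hasFDerivAt_map x).hasFDerivWithinAt) Q.map_injective.injOn]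
  simp only [abs_det_frame]
  exact integrable_smul_iff (pow_pos Q.side_pos n).ne' _

theorem integrableOn_carrier_iff {n : ℕ} (Q : OrientedCube n) (g : Rn n → ℝ) :
    IntegrableOn g Q.carrier ↔ IntegrableOn (fun y => g (Q.map y)) (unitCube n) :=
  Q.integrableOn_map_image_iff (measurableSet_unitCube n) g

theorem average_carrier {n : ℕ} (Q : OrientedCube n) (g : Rn n → ℝ) :
    ⨍ x in Q.carrier, g x = ⨍ y in unitCube n, g (Q.map y) := by
  have h1 := Q.integral_map_image (measurableSet_unitCube n) g
  have h2 := Q.integral_map_image (measurableSet_unitCube n) fun _ => 1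
  simp only [setIntegral_const, smul_eq_mul, mul_one] at h2
  rw [setAverage_eq, setAverage_eq, carrier, h1, h2, smul_eq_mul, smul_eq_mul, mul_inv]
  have := (pow_pos Q.side_pos n).ne'
  field_simp

/-! ### Transport of vector fields -/

/-- The field `x ↦ R_Q φ(T_Q⁻¹ x)`. -/
def push {n : ℕ} (Q : OrientedCube n) (φ : Rn n → Rn n) (x : Rn n) : Rn n :=
  Q.frame (φ (Q.invMap x))

theorem contDiff_invMap {n : ℕ} (Q : OrientedCube n) : ContDiff ℝ 1 Q.invMap := by
  unfold invMap
  fun_prop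

theorem hasFDerivAt_invMap {n : ℕ} (Q : OrientedCube n) (x : Rn n) :
    HasFDerivAt Q.invMap (Q.side⁻¹ • (Q.frame.symm : Rn n →L[ℝ] Rn n)) x := by
  have : Q.invMap = fun x => Q.side⁻¹ • (Q.frame.symm : Rn n →L[ℝ] Rn n) (x - Q.center) := by
    funext x
    simp [invMap]
  rw [this]
  exact ((Q.frame.symm : Rn n →L[ℝ] Rn n).hasFDerivAt.comp x
    ((hasFDerivAt_id x).sub_const Q.center)).const_smul Q.side⁻¹

theorem tsupport_push {n : ℕ} (Q : OrientedCube n) (φ : Rn n → Rn n) :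
    tsupport (Q.push φ) = Q.map '' tsupport φ := by
  have h1 : Function.support (Q.push φ) = Q.map '' Function.support φ := by
    ext x
    obtain ⟨y, rfl⟩ := Q.map_surjective x
    rw [Q.map_injective.mem_set_image]
    simp [push]
  rw [tsupport, h1, tsupport]
  exact (Q.homeomorph.image_closure _).symm

theorem isField_push {n : ℕ} (Q : OrientedCube n) {U : Set (Rn n)} {φ : Rn n → Rn n}
    (hφ : IsField U φ) : IsField (Q.map '' U) (Q.push φ) where
  contDiff := by
    unfold push
    exact Q.frame.contDiff.comp (hφ.contDiff.comp Q.contDiff_invMap)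
  hasCompactSupport := by
    rw [HasCompactSupport, tsupport_push]
    exact hφ.hasCompactSupport.image Q.continuous_map
  tsupport_subset := by
    rw [tsupport_push]
    exact Set.image_mono hφ.tsupport_subset

theorem isTestField_push {n : ℕ} (Q : OrientedCube n) {U : Set (Rn n)} {φ : Rn n → Rn n}
    (hφ : IsTestField U φ) : IsTestField (Q.map '' U) (Q.push φ) :=
  (Q.isField_push hφ.isField).isTestField fun x => by
    simpa [push] using hφ.norm_le_one _

end OrientedCube

/-- The trace is invariant under conjugation, so the divergence does not see the rotation of the
axes of a cube. -/
theorem divergence_eq_trace {n : ℕ} (φ : Rn n → Rn n) (x : Rn n) :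
    divergence φ x = LinearMap.trace ℝ (Rn n) (fderiv ℝ φ x : Rn n →ₗ[ℝ] Rn n) := by
  rw [LinearMap.trace_eq_sum_inner _ (EuclideanSpace.basisFun (Fin n) ℝ)]
  simp [divergence, EuclideanSpace.basisFun_apply, EuclideanSpace.inner_single_left]

theorem OrientedCube.divergence_push {n : ℕ} (Q : OrientedCube n) {φ : Rn n → Rn n} {x : Rn n}
    (hφ : DifferentiableAt ℝ φ (Q.invMap x)) :
    divergence (Q.push φ) x = Q.side⁻¹ * divergence φ (Q.invMap x) := by
  rw [divergence_eq_trace, divergence_eq_trace]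
  have h1 : HasFDerivAt (Q.push φ) ((Q.frame : Rn n →L[ℝ] Rn n).comp
      ((fderiv ℝ φ (Q.invMap x)).comp (Q.side⁻¹ • (Q.frame.symm : Rn n →L[ℝ] Rn n)))) x :=
    (Q.frame : Rn n →L[ℝ] Rn n).hasFDerivAt.comp x
      (hφ.hasFDerivAt.comp x (Q.hasFDerivAt_invMap x))
  rw [h1.fderiv]
  have h2 : (((Q.frame : Rn n →L[ℝ] Rn n).comp ((fderiv ℝ φ (Q.invMap x)).comp
      (Q.side⁻¹ • (Q.frame.symm : Rn n →L[ℝ] Rn n))) : Rn n →L[ℝ] Rn n) : Rn n →ₗ[ℝ] Rn n)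
      = Q.side⁻¹ • Q.frame.toLinearEquiv.conj (fderiv ℝ φ (Q.invMap x) : Rn n →ₗ[ℝ] Rn n) := by
    ext y
    simp [LinearEquiv.conj_apply]
  rw [h2, map_smul, LinearMap.trace_conj', smul_eq_mul]

theorem OrientedCube.pairing_push {n : ℕ} (hn : 1 ≤ n) (f : Rn n → ℝ) (Q : OrientedCube n)
    {U : Set (Rn n)} {φ : Rn n → Rn n} (hφ : IsField U φ) :
    pairing f (Q.push φ) = Q.side ^ (n - 1) * pairing (fun y => f (Q.map y)) φ := by
  have h1 := Q.integral_map_image MeasurableSet.univ fun x => f x * divergence (Q.push φ) x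
  rw [Set.image_univ, Q.map_surjective.range_eq, setIntegral_univ, setIntegral_univ] at h1
  have h2 : ∀ y, divergence (Q.push φ) (Q.map y) = Q.side⁻¹ * divergence φ y := fun y => by
    rw [Q.divergence_push (hφ.differentiableAt _), Q.invMap_map]
  unfold pairing
  rw [h1]
  have h3 : ∀ y, f (Q.map y) * (Q.side⁻¹ * divergence φ y)
      = Q.side⁻¹ * (f (Q.map y) * divergence φ y) := fun y => by ring
  simp only [h2, h3]
  rw [integral_const_mul, ← mul_assoc]
  congr 1
  -- The Jacobian `ℓⁿ` times the factor `ℓ⁻¹` of the divergence gives `ℓⁿ⁻¹`; `n ≥ 1` is needed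
  -- because the exponent is a truncated subtraction.
  obtain ⟨m, rfl⟩ := Nat.exists_eq_add_of_le' hn
  have := Q.side_pos.ne'
  rw [Nat.add_sub_cancel, pow_succ]
  field_simp

/-- Integration by parts against the constant `1`. Consequently the mean subtracted in `f_Q` has no
effect on pairings. -/
theorem integral_divergence_eq_zero {n : ℕ} {U : Set (Rn n)} {φ : Rn n → Rn n}
    (hφ : IsField U φ) : ∫ x, divergence φ x = 0 := by
  have hcomp : ∀ i x v, fderiv ℝ (fun x => φ x i) x v = fderiv ℝ φ x v i := fun i x v => by
    have : HasFDerivAt (fun x => φ x i)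
        ((EuclideanSpace.proj i : Rn n →L[ℝ] ℝ).comp (fderiv ℝ φ x)) x :=
      (EuclideanSpace.proj i : Rn n →L[ℝ] ℝ).hasFDerivAt.comp x (hφ.differentiableAt x).hasFDerivAt
    rw [this.fderiv]
    rfl
  have hcont : ∀ i : Fin n, Continuous fun x => fderiv ℝ φ x (EuclideanSpace.single i 1) i :=
    fun i => by
      have := hφ.contDiff.continuous_fderiv one_ne_zero
      fun_prop
  have hint : ∀ i : Fin n, Integrable fun x => fderiv ℝ φ x (EuclideanSpace.single i 1) i :=
    fun i => (hcont i).integrable_of_hasCompactSupport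
      (hφ.hasCompactSupport.mono' fun x hx => by
        by_contra h
        exact hx (by simp [fderiv_of_notMem_tsupport (𝕜 := ℝ) h]))
  unfold divergence
  rw [integral_finsetSum _ fun i _ => hint i]
  refine Finset.sum_eq_zero fun i _ => ?_
  have hd : ∀ x, DifferentiableAt ℝ (fun x => φ x i) x := fun x => by
    exact (EuclideanSpace.proj i : Rn n →L[ℝ] ℝ).differentiableAt.comp x (hφ.differentiableAt x)
  have hφi : Continuous fun x => φ x i := by
    have := hφ.contDiff.continuous
    fun_prop
  have hφint : Integrable fun x => φ x i := hφi.integrable_of_hasCompactSupport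
    (hφ.hasCompactSupport.mono' fun x hx => by
      by_contra h
      exact hx (by simp [image_eq_zero_of_notMem_tsupport h]))
  have h := integral_mul_fderiv_eq_neg_fderiv_mul_of_integrable (μ := volume)
    (f := fun _ : Rn n => (1 : ℝ)) (g := fun x => φ x i) (v := EuclideanSpace.single i 1)
    (by simp) (by simpa [hcomp] using hint i)
    (by simpa using hφint)
    (fun x _ => differentiableAt_const _) (fun x _ => hd x)
  simpa [hcomp] using h

/-! ### Rescalings -/

theorem rescale_eq {n : ℕ} (f : Rn n → ℝ) (Q : OrientedCube n) (y : Rn n) :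
    rescale f Q y = Q.side ^ (n - 1) / (variation f Q.carrier).toReal *
      (f (Q.map y) - ⨍ z in unitCube n, f (Q.map z)) := by
  rw [rescale, Q.average_carrier]
  ring

theorem integrableOn_rescale {n : ℕ} {f : Rn n → ℝ} {Q : OrientedCube n}
    (hf : IntegrableOn f Q.carrier) : IntegrableOn (rescale f Q) (unitCube n) := by
  have h1 := (Q.integrableOn_carrier_iff f).1 hf
  have h2 : IntegrableOn (fun _ : Rn n => ⨍ z in unitCube n, f (Q.map z)) (unitCube n) :=
    integrableOn_const (volume_unitCube_lt_top n).ne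
  have h3 := (h1.sub h2).const_mul (Q.side ^ (n - 1) / (variation f Q.carrier).toReal)
  refine h3.congr (Filter.Eventually.of_forall fun y => ?_)
  simp [rescale_eq]

theorem pairing_rescale {n : ℕ} (hn : 1 ≤ n) {f : Rn n → ℝ} {Q : OrientedCube n}
    (hf : IntegrableOn f Q.carrier) {φ : Rn n → Rn n} (hφ : IsField (unitCube n) φ) :
    pairing (rescale f Q) φ = pairing f (Q.push φ) / (variation f Q.carrier).toReal := by
  have h1 : LocallyIntegrableOn (fun y => f (Q.map y)) (unitCube n) :=
    ((Q.integrableOn_carrier_iff f).1 hf).locallyIntegrableOn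
  set c := ⨍ z in unitCube n, f (Q.map z)
  have h2 : Integrable fun y => c * divergence φ y :=
    hφ.integrable (f := fun _ => c) (locallyIntegrableOn_const c)
  rw [Q.pairing_push hn f hφ]
  unfold pairing
  have h3 : ∀ y, rescale f Q y * divergence φ y = Q.side ^ (n - 1) /
      (variation f Q.carrier).toReal * (f (Q.map y) * divergence φ y - c * divergence φ y) :=
    fun y => by
      rw [rescale_eq]
      ring
  simp only [h3]
  rw [integral_const_mul, integral_sub (hφ.integrable h1) h2, integral_const_mul,
    integral_divergence_eq_zero hφ]
  ring

/-! ### Coverings by cubes -/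

/-- The cubes that are admitted in the blow-up sequences at `a`. -/
structure IsAdmissible {n : ℕ} (τ : ℝ) (f : Rn n → ℝ) (Ω : Set (Rn n)) (a : Rn n)
    (Q : OrientedCube n) : Prop where
  subset : Q.carrier ⊆ Ω
  isBV : IsBV f Q.carrier
  variation_pos : 0 < variation f Q.carrier
  mem_contraction : a ∈ Q.contraction τ

instance {n : ℕ} : Nonempty (OrientedCube n) :=
  ⟨⟨0, 1, one_pos, LinearIsometryEquiv.refl ℝ (Rn n)⟩⟩

theorem OrientedCube.carrier_subset_ball {n : ℕ} {τ : ℝ} (h0 : 0 ≤ τ) (h1 : τ < 1)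
    {Q : OrientedCube n} {a : Rn n} (ha : a ∈ Q.contraction τ) {r : ℝ}
    (hr : Q.side < r / (2 * (n + 1))) : Q.carrier ⊆ Metric.ball a r := by
  refine (Q.isRoundConvex h0 h1 ha).subset_closedBall.trans (Metric.closedBall_subset_ball ?_)
  have h2 : 0 < 1 - τ := by linarith
  rw [lt_div_iff₀ (by positivity)] at hr
  calc 4 * ((n : ℝ) + 1) / (1 - τ) * ((1 - τ) / 2 * Q.side) = Q.side * (2 * (n + 1)) := by
        field_simp
        norm_num
    _ < r := hr

theorem exists_countable_covering_cubes (n : ℕ) {τ : ℝ} (h0 : 0 ≤ τ) (h1 : τ < 1) :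
    ∃ N : ℕ, ∀ (A : Set (Rn n)) (Q : Rn n → OrientedCube n),
      (∀ a ∈ A, a ∈ (Q a).contraction τ) → (∀ a ∈ A, (Q a).side ≤ 1) →
      ∃ S ⊆ A, S.Countable ∧ A ⊆ ⋃ a ∈ S, (Q a).carrier ∧
        ∀ (z : Rn n) (F : Finset (Rn n)), ↑F ⊆ S → (∀ a ∈ F, z ∈ (Q a).carrier) →
          F.card ≤ N := by
  obtain ⟨N, hN⟩ := exists_countable_covering_bounded_overlap (Rn n)
    (OrientedCube.one_le_roundness (n := n) h0 h1)
  refine ⟨N, fun A Q hQ hs => hN A (fun a => (Q a).carrier) (fun a => (1 - τ) / 2 * (Q a).side)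
    (fun a ha => (Q a).isRoundConvex h0 h1 (hQ a ha)) (fun a ha => ?_)
    fun a _ => (Q a).isOpen_carrier⟩
  have := hs a ha
  have := (Q a).side_pos
  nlinarith

theorem outerVariation_le_of_sum_le {n : ℕ} {f : Rn n → ℝ} {Ω : Set (Rn n)} (hΩ : IsOpen Ω)
    (hf : LocallyIntegrableOn f Ω) {A S : Set (Rn n)} {Q : Rn n → OrientedCube n}
    (hS : S.Countable) (hA : A ⊆ ⋃ a ∈ S, (Q a).carrier) (hQ : ∀ a ∈ S, (Q a).carrier ⊆ Ω)
    (hfin : ∀ a ∈ S, variation f (Q a).carrier ≠ ∞) {K : ℝ}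
    (hK : ∀ F : Finset (Rn n), ↑F ⊆ S → ∑ a ∈ F, (variation f (Q a).carrier).toReal ≤ K) :
    outerVariation f Ω A ≤ ENNReal.ofReal K := by
  calc outerVariation f Ω A ≤ outerVariation f Ω (⋃ a ∈ S, (Q a).carrier) := by gcongr
    _ ≤ ∑' a : S, outerVariation f Ω (Q a).carrier := measure_biUnion_le _ hS _
    _ = ∑' a : S, variation f (Q a).carrier := by
      congr 1 with a
      exact outerVariation_of_isOpen_subset hΩ hf (Q a).isOpen_carrier (hQ a a.2)
    _ ≤ ENNReal.ofReal K := by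
      rw [ENNReal.tsum_eq_iSup_sum]
      refine iSup_le fun F => ?_
      have h1 := hK (F.map (Function.Embedding.subtype _)) (by
        intro a ha
        simp only [Finset.coe_map, Set.mem_image] at ha
        obtain ⟨b, -, rfl⟩ := ha
        exact b.2)
      rw [Finset.sum_map] at h1
      rw [← ENNReal.ofReal_toReal (ENNReal.sum_ne_top.2 fun (a : S) _ => hfin a a.2),
        ENNReal.toReal_sum fun (a : S) _ => hfin a a.2]
      exact ENNReal.ofReal_le_ofReal h1

/-- At `x` only a set `G` of at most `N` corrections is active. Giving each of them its own copy of
`φ` leaves `N - |G|` copies of `φ` and `|G|` terms `φ + v a`, all of norm at most `1`. -/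
theorem norm_smul_add_sum_le {n N : ℕ} {φ : Rn n → Rn n} (hφ : ∀ x, ‖φ x‖ ≤ 1)
    {F : Finset (Rn n)} {v : Rn n → Rn n → Rn n} {C : Rn n → Set (Rn n)} {x : Rn n}
    (hv : ∀ a ∈ F, ‖φ x + v a x‖ ≤ 1) (hC : ∀ a ∈ F, x ∉ C a → v a x = 0)
    (hN : ∀ G : Finset (Rn n), G ⊆ F → (∀ a ∈ G, x ∈ C a) → G.card ≤ N) :
    ‖(N : ℝ) • φ x + ∑ a ∈ F, v a x‖ ≤ N := by
  classical
  set G := F.filter fun a => x ∈ C a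
  have hG : G ⊆ F := Finset.filter_subset _ _
  have hcard : G.card ≤ N := hN G hG fun a ha => (Finset.mem_filter.1 ha).2
  have h1 : ∑ a ∈ F, v a x = ∑ a ∈ G, v a x :=
    (Finset.sum_subset hG fun a ha hag => hC a ha fun h => hag (Finset.mem_filter.2 ⟨ha, h⟩)).symm
  have h2 : (N : ℝ) • φ x + ∑ a ∈ G, v a x
      = ((N : ℝ) - G.card) • φ x + ∑ a ∈ G, (φ x + v a x) := by
    rw [Finset.sum_add_distrib, Finset.sum_const, sub_smul, ← Nat.cast_smul_eq_nsmul ℝ]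
    abel
  have hcard' : (G.card : ℝ) ≤ N := by exact_mod_cast hcard
  rw [h1, h2]
  calc ‖((N : ℝ) - G.card) • φ x + ∑ a ∈ G, (φ x + v a x)‖
      ≤ ‖((N : ℝ) - G.card) • φ x‖ + ∑ a ∈ G, ‖φ x + v a x‖ :=
        (norm_add_le _ _).trans (by gcongr; exact norm_sum_le _ _)
    _ ≤ ((N : ℝ) - G.card) * 1 + ∑ _a ∈ G, 1 := by
        rw [norm_smul, Real.norm_of_nonneg (sub_nonneg.2 hcard')]
        exact add_le_add (mul_le_mul_of_nonneg_left (hφ x) (sub_nonneg.2 hcard'))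
          (Finset.sum_le_sum fun a ha => hv a (hG ha))
    _ = N := by simp

/-- If the test field `φ` can be improved, near each point of `A`, by a definite fraction of the
variation in a cube, then the measure of `A` is controlled by the deficit of `φ`. -/
theorem exists_outerVariation_le_of_competitors (n : ℕ) {τ : ℝ} (h0 : 0 ≤ τ) (h1 : τ < 1) :
    ∃ N : ℕ, ∀ (f : Rn n → ℝ) (Ω O A : Set (Rn n)) (φ : Rn n → Rn n) (c : ℝ), IsOpen Ω →
      LocallyIntegrableOn f Ω → O ⊆ Ω → variation f O ≠ ∞ → IsTestField O φ → 0 < c →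
      (∀ a ∈ A, ∃ (Q : OrientedCube n) (v : Rn n → Rn n), a ∈ Q.contraction τ ∧ Q.side ≤ 1 ∧
        Q.carrier ⊆ Ω ∧ variation f Q.carrier ≠ ∞ ∧ IsField (Q.carrier ∩ O) v ∧
        (∀ x, ‖φ x + v x‖ ≤ 1) ∧ c * (variation f Q.carrier).toReal ≤ pairing f v) →
      outerVariation f Ω A
        ≤ ENNReal.ofReal (N * ((variation f O).toReal - pairing f φ) / c) := by
  obtain ⟨N, hN⟩ := exists_countable_covering_cubes n h0 h1
  refine ⟨N, fun f Ω O A φ c hΩ hf hO hfin hφ hc hA => ?_⟩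
  choose! Q v hQ hs hQΩ hQfin hv hv1 hvc using hA
  obtain ⟨S, hSA, hScount, hcov, hover⟩ := hN A Q hQ hs
  refine outerVariation_le_of_sum_le hΩ hf hScount hcov (fun a ha => hQΩ a (hSA ha))
    (fun a ha => hQfin a (hSA ha)) fun F hF => ?_
  have hFA : ∀ a ∈ F, a ∈ A := fun a ha => hSA (hF ha)
  have hvO : ∀ a ∈ F, IsField O (v a) := fun a ha => (hv a (hFA a ha)).mono Set.inter_subset_right
  have hsum : IsField O fun x => ∑ a ∈ F, v a x := IsField.sum F hvO
  have hφN := hφ.isField.const_smul (N : ℝ)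
  -- The field `N φ + ∑ v a` is a competitor of norm at most `N`, so the total gain of the
  -- corrections is at most `N` times the deficit of `φ`, uniformly in the finite set `F`.
  have hle := pairing_le_mul_variation hfin (hφN.add hsum) (c := N) fun x =>
    norm_smul_add_sum_le (C := fun a => (Q a).carrier) hφ.norm_le_one
      (fun a ha => hv1 a (hFA a ha) x)
      (fun a ha hx => image_eq_zero_of_notMem_tsupport fun h =>
        hx ((hv a (hFA a ha)).tsupport_subset h).1)
      fun G hG hx => hover x G ((Finset.coe_subset.2 hG).trans hF) hx
  have hfO : LocallyIntegrableOn f O := hf.mono_set hO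
  rw [pairing_add hfO hφN hsum, pairing_const_smul f hφ.isField, pairing_sum hfO F hvO] at hle
  rw [le_div_iff₀ hc, Finset.sum_mul]
  calc ∑ a ∈ F, (variation f (Q a).carrier).toReal * c ≤ ∑ a ∈ F, pairing f (v a) :=
        Finset.sum_le_sum fun a ha => by
          rw [mul_comm]
          exact hvc a (hFA a ha)
    _ ≤ N * ((variation f O).toReal - pairing f φ) := by linarith

theorem outerVariation_null_of_locally {n : ℕ} {f : Rn n → ℝ} {Ω A : Set (Rn n)}
    (hΩ : IsOpen Ω) (hf : IsBVLoc f Ω) (hA : A ⊆ Ω)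
    (h : ∀ W : Set (Rn n), IsOpen W → W ⊆ Ω → variation f W ≠ ∞ →
      outerVariation f Ω (A ∩ W) = 0) : outerVariation f Ω A = 0 := by
  refine measure_null_of_locally_null A fun a ha => ?_
  obtain ⟨r, hr, hrΩ⟩ := Metric.nhds_basis_closedBall.mem_iff.1 (hΩ.mem_nhds (hA ha))
  have hcl : closure (Metric.ball a r) ⊆ Metric.closedBall a r := Metric.closure_ball_subset_closedBall
  have hfin := hf.2 (Metric.ball a r) Metric.isOpen_ball
    ((isCompact_closedBall a r).of_isClosed_subset isClosed_closure hcl) (hcl.trans hrΩ)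
  exact ⟨A ∩ Metric.ball a r, inter_mem_nhdsWithin A (Metric.ball_mem_nhds a hr),
    h _ Metric.isOpen_ball (Metric.ball_subset_closedBall.trans hrΩ) hfin.ne⟩

theorem eq_zero_of_forall_le_ofReal_mul {x : ℝ≥0∞} {K : ℝ} (hK : 0 ≤ K)
    (h : ∀ ε : ℝ, 0 < ε → x ≤ ENNReal.ofReal (K * ε)) : x = 0 := by
  by_contra hx
  have hx0 : 0 < x := pos_iff_ne_zero.2 hx
  have hfin : x ≠ ∞ := ((h 1 one_pos).trans_lt ENNReal.ofReal_lt_top).ne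
  have hxr : 0 < x.toReal := ENNReal.toReal_pos hx hfin
  have h1 := h (x.toReal / (2 * (K + 1))) (by positivity)
  rw [ENNReal.le_ofReal_iff_toReal_le hfin (by positivity)] at h1
  have h2 : K * (x.toReal / (2 * (K + 1))) ≤ x.toReal / 2 := by
    rw [mul_div_assoc', div_le_div_iff₀ (by positivity) (by positivity)]
    nlinarith
  linarith

/-! ### The derivative is asymptotically unidirectional -/

/-- At small cubes `Q` around `a`, the derivative of `f` has almost the constant direction `e`, up
to an error `ε |Df|(Q)`. -/
def IsUnidirectional {n : ℕ} (τ : ℝ) (f : Rn n → ℝ) (Ω : Set (Rn n)) (ε : ℝ) (a : Rn n) : Prop :=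
  ∃ e : Rn n, ‖e‖ ≤ 1 ∧ ∃ δ > 0, ∀ Q, IsAdmissible τ f Ω a Q → Q.side < δ →
    ∀ η : Rn n → ℝ, ContDiff ℝ 1 η → HasCompactSupport η → tsupport η ⊆ Q.carrier →
      (∀ x, 0 ≤ η x ∧ η x ≤ 1) → ∀ O : Set (Rn n), (∀ x ∈ O, η x = 1) →
        (variation f O).toReal ≤ pairing f (fun x => η x • e) + ε * (variation f Q.carrier).toReal

/-- An almost optimal test field `φ` is continuous, hence nearly constant on small cubes. Where `e =
φ a` fails to capture the variation, `φ` can be improved by a definite fraction of `|Df|(Q)`, which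
can happen only on a set of measure comparable to the deficit of `φ`. -/
theorem outerVariation_not_isUnidirectional {n : ℕ} {f : Rn n → ℝ} {Ω : Set (Rn n)}
    (hΩ : IsOpen Ω) (hf : IsBVLoc f Ω) {τ : ℝ} (h0 : 0 ≤ τ) (h1 : τ < 1) {ε : ℝ} (hε : 0 < ε) :
    outerVariation f Ω {a | a ∈ Ω ∧ ¬ IsUnidirectional τ f Ω ε a} = 0 := by
  refine outerVariation_null_of_locally hΩ hf (fun a ha => ha.1) fun W hW hWΩ hWfin => ?_
  obtain ⟨N, hN⟩ := exists_outerVariation_le_of_competitors n h0 h1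
  refine eq_zero_of_forall_le_ofReal_mul (K := N / (ε / 2)) (by positivity) fun ε' hε' => ?_
  obtain ⟨φ, hφ, hφε⟩ := exists_lt_pairing_of_lt_toReal (f := f) (U := W)
    (c := (variation f W).toReal - ε') (by linarith)
  refine (hN f Ω W _ φ (ε / 2) hΩ hf.1 hWΩ hWfin hφ (by positivity) ?_).trans
    (ENNReal.ofReal_le_ofReal ?_)
  swap
  · rw [div_mul_eq_mul_div]
    gcongr
    linarith
  rintro a ⟨⟨-, ha⟩, haW⟩
  obtain ⟨r₁, hr₁, hr₁W⟩ := Metric.isOpen_iff.1 hW a haW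
  obtain ⟨r₂, hr₂, hr₂φ⟩ := Metric.continuousAt_iff.1
    (hφ.contDiff.continuous.continuousAt : ContinuousAt φ a) (ε / 2) (by positivity)
  have hr : 0 < min r₁ r₂ := lt_min hr₁ hr₂
  rw [IsUnidirectional] at ha
  push Not at ha
  obtain ⟨Q, hQ, hside, η, hη, hηc, hηQ, hη01, O, hO, hlt⟩ := ha (φ a) (hφ.norm_le_one a)
    (min 1 (min r₁ r₂ / (2 * (n + 1)))) (by positivity)
  have hQball := OrientedCube.carrier_subset_ball h0 h1 hQ.mem_contraction
    (hside.trans_le (min_le_right _ _))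
  have hQW : Q.carrier ⊆ W :=
    (hQball.trans (Metric.ball_subset_ball (min_le_left _ _))).trans hr₁W
  have hQfin : variation f Q.carrier ≠ ∞ := hQ.isBV.2.ne
  have hfQ : LocallyIntegrableOn f Q.carrier := hf.1.mono_set hQ.subset
  have hOQ : O ⊆ Q.carrier := fun x hx => hηQ (subset_tsupport η (by simp [hO x hx]))
  have hF1 : IsField Q.carrier fun x => η x • φ x :=
    IsField.cutoff_smul hφ.contDiff hη hηc hηQ
  have hF2 : IsField Q.carrier fun x => η x • φ a :=
    IsField.cutoff_smul contDiff_const hη hηc hηQ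
  have hdiff : pairing f (fun x => η x • φ x) - pairing f (fun x => η x • φ a)
      ≤ ε / 2 * (variation f Q.carrier).toReal := by
    rw [← pairing_sub hfQ hF1 hF2]
    refine pairing_le_mul_variation hQfin (hF1.sub hF2) fun x => ?_
    rw [← smul_sub, norm_smul, Real.norm_of_nonneg (hη01 x).1]
    by_cases hx : x ∈ Q.carrier
    · have h2 := hr₂φ ((Metric.ball_subset_ball (min_le_right _ _)) (hQball hx))
      rw [dist_eq_norm] at h2
      calc η x * ‖φ x - φ a‖ ≤ 1 * (ε / 2) := by
            gcongr
            exact (hη01 x).2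
        _ = ε / 2 := one_mul _
    · rw [image_eq_zero_of_notMem_tsupport fun h => hx (hηQ h), zero_mul]
      positivity
  -- The improvement is `w - η φ` with `w` almost optimal in `O`: adding it to `φ` gives `w` on `O`,
  -- where `η = 1`, and `(1 - η) φ` elsewhere. Half of `ε` pays for replacing `φ a` by `φ`; the
  -- other half is the gain.
  obtain ⟨w, hw, hwlt⟩ := exists_lt_pairing_of_lt_toReal (f := f) (U := O)
    (c := pairing f (fun x => η x • φ x) + ε / 2 * (variation f Q.carrier).toReal) (by linarith)
  refine ⟨Q, fun x => w x - η x • φ x, hQ.mem_contraction,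
    (hside.trans_le (min_le_left _ _)).le, hQ.subset, hQfin, ?_, fun x => ?_, ?_⟩
  · rw [Set.inter_eq_left.2 hQW]
    exact (hw.isField.mono hOQ).sub hF1
  · by_cases hx : x ∈ O
    · simpa [hO x hx] using hw.norm_le_one x
    · have hw0 : w x = 0 := image_eq_zero_of_notMem_tsupport fun h => hx (hw.tsupport_subset h)
      have : φ x + (w x - η x • φ x) = (1 - η x) • φ x := by
        rw [hw0, sub_smul, one_smul]
        abel
      rw [this, norm_smul, Real.norm_of_nonneg (by linarith [(hη01 x).2])]
      exact mul_le_one₀ (by linarith [(hη01 x).1]) (norm_nonneg _) (hφ.norm_le_one x)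
  · rw [pairing_sub hfQ (hw.isField.mono hOQ) hF1]
    linarith

/-! ### Points at which a set is not too sparse -/

/-- A one-sided density theorem, valid for non-measurable `A`. The sets `O` missing `A` lie in a
tight open neighbourhood `V` of the exceptional points, so their union has small variation, but it
carries a fixed fraction of each cube of a covering. -/
theorem outerVariation_sparse_eq_zero {n : ℕ} {f : Rn n → ℝ} {Ω : Set (Rn n)}
    (hΩ : IsOpen Ω) (hf : IsBVLoc f Ω) {τ : ℝ} (h0 : 0 ≤ τ) (h1 : τ < 1) {A : Set (Rn n)}
    {c : ℝ} (hc : 0 < c) :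
    outerVariation f Ω {a | a ∈ A ∧ a ∈ Ω ∧ ∀ δ > 0, ∃ Q, IsAdmissible τ f Ω a Q ∧ Q.side < δ ∧
      ∃ O : Set (Rn n), IsOpen O ∧ O ⊆ Q.carrier ∧ Disjoint O A ∧
        c * (variation f Q.carrier).toReal ≤ (variation f O).toReal} = 0 := by
  refine outerVariation_null_of_locally hΩ hf (fun a ha => ha.2.1) fun W hW hWΩ hWfin => ?_
  set B : Set (Rn n) := _ ∩ W with hB
  obtain ⟨N, hN⟩ := exists_outerVariation_le_of_competitors n h0 h1
  have hBfin : outerVariation f Ω B ≠ ∞ := by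
    refine ne_top_of_le_ne_top hWfin ?_
    rw [← outerVariation_of_isOpen_subset hΩ hf.1 hW hWΩ]
    exact measure_mono Set.inter_subset_right
  refine eq_zero_of_forall_le_ofReal_mul (K := N / (c / 2)) (by positivity) fun ε hε => ?_
  obtain ⟨V, hV, hBV, hVW, hVlt⟩ := exists_isOpen_variation_lt hΩ hf.1 hW hWΩ
    (Set.inter_subset_right : B ⊆ W) hBfin (ε := ENNReal.ofReal ε) (by simpa using hε)
  have hVΩ := hVW.trans hWΩ
  have hex : ∀ a ∈ B, ∃ (Q : OrientedCube n) (O : Set (Rn n)), IsAdmissible τ f Ω a Q ∧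
      Q.side ≤ 1 ∧ Q.carrier ⊆ V ∧ IsOpen O ∧ O ⊆ Q.carrier ∧ Disjoint O A ∧
        c * (variation f Q.carrier).toReal ≤ (variation f O).toReal := by
    intro a ha
    obtain ⟨r, hr, hrV⟩ := Metric.isOpen_iff.1 hV a (hBV ha)
    obtain ⟨Q, hQ, hside, O, hO, hOQ, hOA, hle⟩ := ha.1.2.2 (min 1 (r / (2 * (n + 1))))
      (by positivity)
    exact ⟨Q, O, hQ, (hside.trans_le (min_le_left _ _)).le,
      (OrientedCube.carrier_subset_ball h0 h1 hQ.mem_contraction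
        (hside.trans_le (min_le_right _ _))).trans hrV, hO, hOQ, hOA, hle⟩
  choose! Q O hQ hside hQV hO hOQ hOA hle using hex
  set U := ⋃ a ∈ B, O a with hU
  have hUV : U ⊆ V := Set.iUnion₂_subset fun a ha => (hOQ a ha).trans (hQV a ha)
  have hVfin : variation f V ≠ ∞ := ne_top_of_le_ne_top hWfin (variation_mono f hVW)
  have hUfin : variation f U ≠ ∞ := ne_top_of_le_ne_top hVfin (variation_mono f hUV)
  have hUB : Disjoint U B := by
    rw [hU, Set.disjoint_iUnion₂_left]
    exact fun a ha => (hOA a ha).mono_right fun x hx => hx.1.1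
  have hUε : (variation f U).toReal ≤ ε := by
    have h2 := variation_add_outerVariation_diff_le hΩ hf.1 hV hVΩ hUV
    have h3 : outerVariation f Ω B ≤ outerVariation f Ω (V \ U) :=
      measure_mono fun x hx => ⟨hBV hx, fun h => Set.disjoint_left.1 hUB h hx⟩
    have h4 : variation f U + outerVariation f Ω B
        ≤ ENNReal.ofReal ε + outerVariation f Ω B := by
      calc variation f U + outerVariation f Ω B ≤ variation f U + outerVariation f Ω (V \ U) := by
            gcongr
        _ ≤ variation f V := h2
        _ ≤ ENNReal.ofReal ε + outerVariation f Ω B := by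
          rw [add_comm]
          exact hVlt.le
    exact ENNReal.toReal_le_of_le_ofReal hε.le ((ENNReal.add_le_add_iff_right hBfin).1 h4)
  -- The zero field has deficit `|Df|(U) ≤ ε`, and in each cube an almost optimal field of `O a`
  -- improves it.
  refine (hN f Ω U B (fun _ => 0) (c / 2) hΩ hf.1 (hUV.trans hVΩ) hUfin (IsTestField.zero U)
    (by positivity) ?_).trans (ENNReal.ofReal_le_ofReal ?_)
  · intro a ha
    have hQfin : variation f (Q a).carrier ≠ ∞ := (hQ a ha).isBV.2.ne
    have hpos : 0 < (variation f (Q a).carrier).toReal :=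
      ENNReal.toReal_pos (hQ a ha).variation_pos.ne' hQfin
    obtain ⟨w, hw, hwlt⟩ := exists_lt_pairing_of_lt_toReal (f := f) (U := O a)
      (c := c / 2 * (variation f (Q a).carrier).toReal) (by
        have := hle a ha
        nlinarith)
    refine ⟨Q a, w, (hQ a ha).mem_contraction, hside a ha, (hQ a ha).subset, hQfin,
      hw.isField.mono (Set.subset_inter (hOQ a ha) (Set.subset_biUnion_of_mem ha)), ?_, hwlt.le⟩
    simpa using hw.norm_le_one
  · rw [pairing_zero, sub_zero, div_mul_eq_mul_div]
    gcongr

/-! ### The distance of `L¹(Q₀)` -/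

/-- The distance in `L¹(Q₀)`. -/
def cubeDist {n : ℕ} (u v : Rn n → ℝ) : ℝ≥0∞ := ∫⁻ y in unitCube n, ‖u y - v y‖ₑ

theorem cubeDist_comm {n : ℕ} (u v : Rn n → ℝ) : cubeDist u v = cubeDist v u := by
  unfold cubeDist
  congr 1 with y
  rw [← enorm_neg, neg_sub]

theorem cubeDist_triangle {n : ℕ} {u v : Rn n → ℝ} (w : Rn n → ℝ)
    (hu : IntegrableOn u (unitCube n)) (hv : IntegrableOn v (unitCube n)) :
    cubeDist u w ≤ cubeDist u v + cubeDist v w := by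
  have hm : AEMeasurable (fun y => ‖u y - v y‖ₑ) (volume.restrict (unitCube n)) :=
    (hu.sub hv).aestronglyMeasurable.enorm
  unfold cubeDist
  rw [← lintegral_add_left' hm]
  refine lintegral_mono fun y => ?_
  calc ‖u y - w y‖ₑ = ‖(u y - v y) + (v y - w y)‖ₑ := by rw [sub_add_sub_cancel]
    _ ≤ _ := enorm_add_le _ _

theorem cubeDist_comp_map_le {n : ℕ} (h g : Rn n → ℝ) {P : OrientedCube n}
    (hP : P.carrier ⊆ unitCube n) :
    cubeDist (fun y => h (P.map y)) (fun y => g (P.map y))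
      ≤ (ENNReal.ofReal (P.side ^ n))⁻¹ * cubeDist h g := by
  have h1 := P.lintegral_map_image (measurableSet_unitCube n) fun x => ‖h x - g x‖ₑ
  have h2 : 0 < ENNReal.ofReal (P.side ^ n) := by
    rw [ENNReal.ofReal_pos]
    exact pow_pos P.side_pos n
  unfold cubeDist
  rw [← ENNReal.mul_le_iff_le_inv h2.ne' ENNReal.ofReal_ne_top, ← h1]
  exact lintegral_mono_set hP

theorem integrableOn_comp_map {n : ℕ} {u : Rn n → ℝ} (hu : IntegrableOn u (unitCube n))
    {P : OrientedCube n} (hP : P.carrier ⊆ unitCube n) :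
    IntegrableOn (fun y => u (P.map y)) (unitCube n) :=
  (P.integrableOn_carrier_iff u).1 (hu.mono_set hP)

/-- `Pᵢ → Q`, for cubes with the same axes. -/
structure CubesTendsto {n : ℕ} (P : ℕ → OrientedCube n) (Q : OrientedCube n) : Prop where
  center : Tendsto (fun i => (P i).center) atTop (𝓝 Q.center)
  side : Tendsto (fun i => (P i).side) atTop (𝓝 Q.side)
  frame : ∀ i, (P i).frame = Q.frame

theorem CubesTendsto.map {n : ℕ} {P : ℕ → OrientedCube n} {Q : OrientedCube n}
    (h : CubesTendsto P Q) (y : Rn n) : Tendsto (fun i => (P i).map y) atTop (𝓝 (Q.map y)) := by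
  simp only [OrientedCube.map, h.frame]
  exact h.center.add (h.side.smul_const _)

theorem CubesTendsto.inv_ofReal {n : ℕ} {P : ℕ → OrientedCube n} {Q : OrientedCube n}
    (h : CubesTendsto P Q) : Tendsto (fun i => (ENNReal.ofReal ((P i).side ^ n))⁻¹) atTop
      (𝓝 (ENNReal.ofReal (Q.side ^ n))⁻¹) :=
  (ENNReal.tendsto_ofReal (h.side.pow n)).inv

theorem inv_ofReal_side_pow_ne_top {n : ℕ} (Q : OrientedCube n) :
    (ENNReal.ofReal (Q.side ^ n))⁻¹ ≠ ∞ := by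
  rw [ENNReal.inv_ne_top]
  exact (ENNReal.ofReal_pos.2 (pow_pos Q.side_pos n)).ne'

/-- Membership of a point in a cube is an open condition jointly in the point, the sidelength and
the centre, hence uniform over the compact set `K`. -/
theorem CubesTendsto.eventually_subset {n : ℕ} {P : ℕ → OrientedCube n} {Q : OrientedCube n}
    (h : CubesTendsto P Q) {K : Set (Rn n)} (hK : IsCompact K) (hKQ : K ⊆ Q.carrier) :
    ∀ᶠ i in atTop, K ⊆ (P i).carrier := by
  have key : ∀ᶠ p : ℝ × Rn n in 𝓝 (Q.side, Q.center), ∀ x ∈ K,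
      Q.frame.symm (p.1⁻¹ • (x - p.2)) ∈ unitCube n := by
    refine hK.eventually_forall_of_forall_eventually
      (P := fun (p : ℝ × Rn n) x => Q.frame.symm (p.1⁻¹ • (x - p.2)) ∈ unitCube n)
      fun x hx => ?_
    obtain ⟨y, hy, rfl⟩ := hKQ hx
    have hcont : ContinuousAt (fun z : (ℝ × Rn n) × Rn n =>
        Q.frame.symm (z.1.1⁻¹ • (z.2 - z.1.2))) ((Q.side, Q.center), Q.map y) := by
      have hinner : ContinuousAt (fun z : (ℝ × Rn n) × Rn n => z.1.1⁻¹ • (z.2 - z.1.2))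
          ((Q.side, Q.center), Q.map y) :=
        ContinuousAt.smul (ContinuousAt.inv₀ continuous_fst.fst.continuousAt Q.side_pos.ne')
          (by fun_prop)
      exact Q.frame.symm.continuous.continuousAt.comp hinner
    refine hcont.eventually ((isOpen_unitCube n).mem_nhds ?_)
    have := Q.invMap_map y
    rw [OrientedCube.invMap] at this
    simpa only [this] using hy
  filter_upwards [(h.side.prodMk_nhds h.center).eventually key] with i hi x hx
  refine ⟨(P i).invMap x, ?_, (P i).map_invMap x⟩
  have := hi x hx
  rwa [← h.frame i] at this

theorem CubesTendsto.cubeDist_comp_continuous {n : ℕ} {P : ℕ → OrientedCube n}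
    {Q : OrientedCube n} (h : CubesTendsto P Q) {g : Rn n → ℝ} (hg : Continuous g)
    (hgc : HasCompactSupport g) :
    Tendsto (fun i => cubeDist (fun y => g ((P i).map y)) fun y => g (Q.map y)) atTop (𝓝 0) := by
  obtain ⟨C, hC⟩ := hg.bounded_above_of_compact_support hgc
  have h0 : (0 : ℝ≥0∞) = ∫⁻ _y in unitCube n, 0 := by simp
  rw [h0]
  unfold cubeDist
  refine tendsto_lintegral_of_dominated_convergence' (fun _ => ENNReal.ofReal (C + C)) ?_ ?_ ?_ ?_
  · intro i
    exact ((hg.comp (P i).continuous_map).sub (hg.comp Q.continuous_map)).enorm.aemeasurable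
  · intro i
    refine Filter.Eventually.of_forall fun y => ?_
    change ‖g _ - g _‖ₑ ≤ _
    rw [← ofReal_norm]
    exact ENNReal.ofReal_le_ofReal ((norm_sub_le _ _).trans (add_le_add (hC _) (hC _)))
  · rw [setLIntegral_const]
    exact ENNReal.mul_ne_top ENNReal.ofReal_ne_top (volume_unitCube_lt_top n).ne
  · refine Filter.Eventually.of_forall fun y => ?_
    have h1 : Tendsto (fun i => g ((P i).map y) - g (Q.map y)) atTop (𝓝 0) := by
      have := (hg.continuousAt.tendsto.comp (h.map y)).sub_const (g (Q.map y))
      simpa using this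
    simpa using h1.enorm

/-- Continuity of translations and dilations in `L¹`: approximate `u` by a continuous function of
compact support and bound the two errors by the Jacobians, which converge. -/
theorem CubesTendsto.cubeDist_comp {n : ℕ} {P : ℕ → OrientedCube n} {Q : OrientedCube n}
    (h : CubesTendsto P Q) (hP : ∀ i, (P i).carrier ⊆ unitCube n) (hQ : Q.carrier ⊆ unitCube n)
    {u : Rn n → ℝ} (hu : IntegrableOn u (unitCube n)) :
    Tendsto (fun i => cubeDist (fun y => u ((P i).map y)) fun y => u (Q.map y)) atTop (𝓝 0) := by
  set c : ℝ≥0∞ := (ENNReal.ofReal (Q.side ^ n))⁻¹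
  have hc : c ≠ ∞ := inv_ofReal_side_pow_ne_top Q
  rw [ENNReal.tendsto_nhds_zero]
  intro ε hε
  obtain ⟨δ, hδ, hδε⟩ := ENNReal.exists_nnreal_pos_mul_lt (ENNReal.add_ne_top.2 ⟨hc, hc⟩) hε.ne'
  obtain ⟨g, hgc, hgu, hg, hgi⟩ := hu.exists_hasCompactSupport_lintegral_sub_le
    (ε := δ) (by simpa using hδ.ne')
  have hgi' : IntegrableOn g (unitCube n) := hgi
  have hdist : cubeDist u g ≤ δ := hgu
  have hlim : Tendsto (fun i => (ENNReal.ofReal ((P i).side ^ n))⁻¹ * δ +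
      cubeDist (fun y => g ((P i).map y)) (fun y => g (Q.map y)) + c * δ) atTop
      (𝓝 (c * δ + 0 + c * δ)) :=
    ((ENNReal.Tendsto.mul_const h.inv_ofReal (Or.inr ENNReal.coe_ne_top)).add
      (h.cubeDist_comp_continuous hg hgc)).add tendsto_const_nhds
  have hlt : c * δ + 0 + c * δ < ε := by
    rwa [add_zero, ← add_mul, mul_comm]
  filter_upwards [hlim.eventually (gt_mem_nhds hlt)] with i hi
  refine le_trans ?_ hi.le
  calc cubeDist (fun y => u ((P i).map y)) (fun y => u (Q.map y))
      ≤ cubeDist (fun y => u ((P i).map y)) (fun y => g ((P i).map y)) +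
        cubeDist (fun y => g ((P i).map y)) (fun y => u (Q.map y)) :=
        cubeDist_triangle _ (integrableOn_comp_map hu (hP i)) (integrableOn_comp_map hgi' (hP i))
    _ ≤ cubeDist (fun y => u ((P i).map y)) (fun y => g ((P i).map y)) +
        (cubeDist (fun y => g ((P i).map y)) (fun y => g (Q.map y)) +
        cubeDist (fun y => g (Q.map y)) (fun y => u (Q.map y))) := by
        gcongr
        exact cubeDist_triangle _ (integrableOn_comp_map hgi' (hP i))
          (integrableOn_comp_map hgi' hQ)
    _ ≤ (ENNReal.ofReal ((P i).side ^ n))⁻¹ * δ +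
        (cubeDist (fun y => g ((P i).map y)) (fun y => g (Q.map y)) + c * δ) := by
        gcongr
        · exact (cubeDist_comp_map_le u g (hP i)).trans (by gcongr)
        · rw [cubeDist_comm]
          exact (cubeDist_comp_map_le u g hQ).trans (by gcongr)
    _ = _ := by rw [add_assoc]

/-! ### Convergence of averages and of normalized functions. -/

theorem tendsto_average_of_cubeDist {n : ℕ} {H : ℕ → Rn n → ℝ} {h : Rn n → ℝ}
    (hH : ∀ i, IntegrableOn (H i) (unitCube n)) (hh : IntegrableOn h (unitCube n))
    (hd : Tendsto (fun i => cubeDist (H i) h) atTop (𝓝 0)) :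
    Tendsto (fun i => ⨍ y in unitCube n, H i y) atTop (𝓝 (⨍ y in unitCube n, h y)) := by
  simp only [setAverage_eq]
  exact (tendsto_integral_of_L1 h hh.aestronglyMeasurable
    (Filter.Eventually.of_forall hH) hd).const_smul _

theorem tendsto_cubeDist_mul_sub_average {n : ℕ} {H : ℕ → Rn n → ℝ} {h : Rn n → ℝ}
    (hH : ∀ i, IntegrableOn (H i) (unitCube n)) (hh : IntegrableOn h (unitCube n))
    (hd : Tendsto (fun i => cubeDist (H i) h) atTop (𝓝 0)) {a : ℕ → ℝ} {b : ℝ}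
    (ha : Tendsto a atTop (𝓝 b)) :
    Tendsto (fun i => cubeDist (fun y => a i * (H i y - ⨍ z in unitCube n, H i z))
      fun y => b * (h y - ⨍ z in unitCube n, h z)) atTop (𝓝 0) := by
  have hav := tendsto_average_of_cubeDist hH hh hd
  set A : ℕ → ℝ := fun i => ⨍ z in unitCube n, H i z
  set B : ℝ := ⨍ z in unitCube n, h z
  have hle : ∀ i, cubeDist (fun y => a i * (H i y - A i)) (fun y => b * (h y - B)) ≤
      ‖a i‖ₑ * cubeDist (H i) h + ‖a i - b‖ₑ * (∫⁻ y in unitCube n, ‖h y‖ₑ) +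
        ‖b * B - a i * A i‖ₑ * volume (unitCube n) := by
    intro i
    have hm : AEMeasurable (fun y => ‖a i - b‖ₑ * ‖h y‖ₑ) (volume.restrict (unitCube n)) :=
      hh.aestronglyMeasurable.enorm.const_mul _
    unfold cubeDist
    rw [← lintegral_const_mul' _ _ enorm_ne_top, ← lintegral_const_mul' _ _ enorm_ne_top,
      ← setLIntegral_const, ← lintegral_add_right' _ hm, ← lintegral_add_right' _ (by fun_prop)]
    refine lintegral_mono fun y => ?_
    have hid : a i * (H i y - A i) - b * (h y - B)
        = a i * (H i y - h y) + (a i - b) * h y + (b * B - a i * A i) := by ring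
    rw [hid, ← enorm_mul, ← enorm_mul]
    exact (enorm_add_le _ _).trans (by gcongr; exact enorm_add_le _ _)
  have h1 : Tendsto (fun i => ‖a i‖ₑ * cubeDist (H i) h) atTop (𝓝 0) := by
    have := ENNReal.Tendsto.mul ha.enorm (Or.inr ENNReal.zero_ne_top) hd (Or.inr enorm_ne_top)
    simpa using this
  have h2 : Tendsto (fun i => ‖a i - b‖ₑ * ∫⁻ y in unitCube n, ‖h y‖ₑ) atTop (𝓝 0) := by
    have h3 : Tendsto (fun i => ‖a i - b‖ₑ) atTop (𝓝 0) := by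
      simpa using (ha.sub_const b).enorm
    have := ENNReal.Tendsto.mul_const h3 (b := ∫⁻ y in unitCube n, ‖h y‖ₑ)
      (Or.inr hh.hasFiniteIntegral.ne)
    simpa using this
  have h4 : Tendsto (fun i => ‖b * B - a i * A i‖ₑ * volume (unitCube n)) atTop (𝓝 0) := by
    have h5 : Tendsto (fun i => ‖b * B - a i * A i‖ₑ) atTop (𝓝 0) := by
      simpa using ((ha.mul hav).const_sub (b * B)).enorm
    have := ENNReal.Tendsto.mul_const h5 (b := volume (unitCube n))
      (Or.inr (volume_unitCube_lt_top n).ne)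
    simpa using this
  refine tendsto_of_tendsto_of_tendsto_of_le_of_le tendsto_const_nhds ?_ (fun _ => zero_le) hle
  simpa using (h1.add h2).add h4

theorem abs_pairing_sub_le {n : ℕ} {h u : Rn n → ℝ} (hh : IntegrableOn h (unitCube n))
    (hu : IntegrableOn u (unitCube n)) (hd : cubeDist h u ≠ ∞) {φ : Rn n → Rn n}
    (hφ : IsField (unitCube n) φ) {C : ℝ} (hC : ∀ x, |divergence φ x| ≤ C) :
    |pairing h φ - pairing u φ| ≤ C * (cubeDist h u).toReal := by
  have hC0 : 0 ≤ C := (abs_nonneg _).trans (hC 0)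
  unfold pairing
  rw [← integral_sub (hφ.integrable hh.locallyIntegrableOn)
    (hφ.integrable hu.locallyIntegrableOn), ← Real.norm_eq_abs]
  rw [← setIntegral_eq_integral_of_forall_compl_eq_zero (s := unitCube n) fun x hx => by
    simp [divergence_of_notMem_tsupport fun h' => hx (hφ.tsupport_subset h')]]
  have h1 := enorm_integral_le_lintegral_enorm (μ := volume.restrict (unitCube n))
    fun x => h x * divergence φ x - u x * divergence φ x
  have h2 : ∫⁻ x in unitCube n, ‖h x * divergence φ x - u x * divergence φ x‖ₑ
      ≤ ENNReal.ofReal C * cubeDist h u := by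
    unfold cubeDist
    rw [← lintegral_const_mul' _ _ ENNReal.ofReal_ne_top]
    refine lintegral_mono fun x => ?_
    rw [← sub_mul, enorm_mul, mul_comm]
    gcongr
    rw [← ofReal_norm]
    exact ENNReal.ofReal_le_ofReal (hC x)
  have h3 := ENNReal.toReal_mono (ENNReal.mul_ne_top ENNReal.ofReal_ne_top hd) (h1.trans h2)
  rwa [toReal_enorm, ENNReal.toReal_mul, ENNReal.toReal_ofReal hC0] at h3

/-! ### Cutoff functions -/

theorem exists_cutoff {n : ℕ} {K U : Set (Rn n)} (hK : IsCompact K) (hU : IsOpen U) (hKU : K ⊆ U) :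
    ∃ η : Rn n → ℝ, ContDiff ℝ 1 η ∧ HasCompactSupport η ∧ tsupport η ⊆ U ∧
      (∀ x, 0 ≤ η x ∧ η x ≤ 1) ∧ ∀ x ∈ K, η x = 1 := by
  obtain ⟨L, hL, hKL, hLU⟩ := exists_compact_between hK hU hKU
  obtain ⟨η, h1, h0, h01⟩ := exists_contMDiffMap_one_nhds_of_subset_interior 𝓘(ℝ, Rn n) (n := 1)
    hK.isClosed hKL
  have hsupp : tsupport η ⊆ L := closure_minimal (fun x hx => by
    by_contra h
    exact hx (h0 x h)) hL.isClosed
  exact ⟨η, contMDiff_iff_contDiff.1 η.contMDiff,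
    hL.of_isClosed_subset (isClosed_tsupport _) hsupp, hsupp.trans hLU, h01,
    fun x hx => h1.self_of_nhdsSet x hx⟩

theorem divergence_smul_const {n : ℕ} {η : Rn n → ℝ} (hη : ContDiff ℝ 1 η) (e x : Rn n) :
    divergence (fun x => η x • e) x = fderiv ℝ η x e := by
  have hd : DifferentiableAt ℝ η x := (hη.differentiable one_ne_zero) x
  have h1 : fderiv ℝ (fun x => η x • e) x = (fderiv ℝ η x).smulRight e :=
    (hd.hasFDerivAt.smul_const e).fderiv
  have h2 : e = ∑ i, e i • EuclideanSpace.single i (1 : ℝ) := by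
    simpa [EuclideanSpace.basisFun_apply] using
      ((EuclideanSpace.basisFun (Fin n) ℝ).sum_repr e).symm
  conv_rhs => rw [h2]
  simp only [divergence, h1, map_sum, map_smul, ContinuousLinearMap.smulRight_apply,
    PiLp.smul_apply, smul_eq_mul]
  exact Finset.sum_congr rfl fun i _ => mul_comm _ _

/-- The bound is uniform in the direction `e`, which is needed because the direction seen in `Q₀`
turns with the frames of the blow-up cubes. -/
theorem exists_bound_divergence_smul_const {n : ℕ} {η : Rn n → ℝ} (hη : ContDiff ℝ 1 η)
    (hc : HasCompactSupport η) :
    ∃ C, ∀ e x : Rn n, ‖e‖ ≤ 1 → |divergence (fun x => η x • e) x| ≤ C := by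
  obtain ⟨C, hC⟩ := (hη.continuous_fderiv one_ne_zero).bounded_above_of_compact_support
    (hc.fderiv (𝕜 := ℝ))
  refine ⟨C, fun e x he => ?_⟩
  rw [divergence_smul_const hη, ← Real.norm_eq_abs]
  calc ‖fderiv ℝ η x e‖ ≤ ‖fderiv ℝ η x‖ * ‖e‖ := ContinuousLinearMap.le_opNorm _ _
    _ ≤ C * 1 := by
      have := hC x
      gcongr
      exact (norm_nonneg _).trans this
    _ = C := mul_one C

/-! ### The normalized variation of the rescalings -/

/-- The variation `|Df_Q|(V) = |Df|(T_Q V) / |Df|(Q)`. -/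
def relVariation {n : ℕ} (f : Rn n → ℝ) (Q : OrientedCube n) (V : Set (Rn n)) : ℝ :=
  (variation f (Q.map '' V)).toReal / (variation f Q.carrier).toReal

theorem variation_map_image_ne_top {n : ℕ} {f : Rn n → ℝ} {Q : OrientedCube n}
    (hf : IsBV f Q.carrier) {V : Set (Rn n)} (hV : V ⊆ unitCube n) :
    variation f (Q.map '' V) ≠ ∞ :=
  ne_top_of_le_ne_top hf.2.ne (variation_mono f (Set.image_mono hV))

theorem relVariation_mono {n : ℕ} {f : Rn n → ℝ} {Q : OrientedCube n}
    (hf : IsBV f Q.carrier) {V W : Set (Rn n)} (hVW : V ⊆ W) (hW : W ⊆ unitCube n) :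
    relVariation f Q V ≤ relVariation f Q W := by
  unfold relVariation
  gcongr
  · exact variation_map_image_ne_top hf hW
  · exact variation_mono f (Set.image_mono hVW)

theorem relVariation_le_one {n : ℕ} {f : Rn n → ℝ} {Q : OrientedCube n}
    (hf : IsBV f Q.carrier) {V : Set (Rn n)} (hV : V ⊆ unitCube n) :
    relVariation f Q V ≤ 1 :=
  (relVariation_mono hf hV Set.Subset.rfl).trans (div_self_le_one _)

theorem pairing_rescale_le_relVariation {n : ℕ} (hn : 1 ≤ n) {f : Rn n → ℝ} {Q : OrientedCube n}
    (hf : IsBV f Q.carrier) {V : Set (Rn n)} (hV : V ⊆ unitCube n) {φ : Rn n → Rn n}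
    (hφ : IsTestField V φ) : pairing (rescale f Q) φ ≤ relVariation f Q V := by
  rw [pairing_rescale hn hf.1 (hφ.isField.mono hV), relVariation]
  gcongr
  exact pairing_le_variation (variation_map_image_ne_top hf hV) (Q.isTestField_push hφ)

theorem tendsto_pairing_rescale {n : ℕ} {f : Rn n → ℝ}
    {Q : ℕ → OrientedCube n} (hf : ∀ j, IsBV f (Q j).carrier) {u : Rn n → ℝ}
    (hu : IntegrableOn u (unitCube n))
    (hd : Tendsto (fun j => cubeDist (rescale f (Q j)) u) atTop (𝓝 0)) {φ : Rn n → Rn n}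
    (hφ : IsField (unitCube n) φ) :
    Tendsto (fun j => pairing (rescale f (Q j)) φ) atTop (𝓝 (pairing u φ)) := by
  obtain ⟨C, -, hC⟩ := hφ.exists_bound_divergence
  have h1 : Tendsto (fun j => C * (cubeDist (rescale f (Q j)) u).toReal) atTop (𝓝 0) := by
    have := ((ENNReal.tendsto_toReal ENNReal.zero_ne_top).comp hd).const_mul C
    simpa using this
  rw [tendsto_iff_dist_tendsto_zero]
  refine squeeze_zero' (Filter.Eventually.of_forall fun _ => dist_nonneg) ?_ h1
  filter_upwards [hd.eventually (gt_mem_nhds ENNReal.zero_lt_top)] with j hj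
  exact abs_pairing_sub_le (integrableOn_rescale (hf j).1) hu hj.ne hφ hC

/-- Lower semicontinuity, also for moving sets `V j`: pairings with a fixed field are continuous in
`L¹`. -/
theorem eventually_lt_relVariation {n : ℕ} (hn : 1 ≤ n) {f : Rn n → ℝ}
    {Q : ℕ → OrientedCube n} (hf : ∀ j, IsBV f (Q j).carrier) {u : Rn n → ℝ}
    (hu : IntegrableOn u (unitCube n))
    (hd : Tendsto (fun j => cubeDist (rescale f (Q j)) u) atTop (𝓝 0)) {φ : Rn n → Rn n}
    (hφ : IsTestField (unitCube n) φ) {V : ℕ → Set (Rn n)} (hV : ∀ j, V j ⊆ unitCube n)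
    (hφV : ∀ᶠ j in atTop, tsupport φ ⊆ V j) {c : ℝ} (hc : c < pairing u φ) :
    ∀ᶠ j in atTop, c < relVariation f (Q j) (V j) := by
  filter_upwards [hφV, (tendsto_pairing_rescale hf hu hd hφ.isField).eventually
    (lt_mem_nhds hc)] with j hj1 hj2
  exact hj2.trans_le (pairing_rescale_le_relVariation hn (hf j) (hV j)
    ⟨hφ.contDiff, hφ.hasCompactSupport, hj1, hφ.norm_le_one⟩)

theorem variation_unitCube_ne_top {n : ℕ} (hn : 1 ≤ n) {f : Rn n → ℝ}
    {Q : ℕ → OrientedCube n} (hf : ∀ j, IsBV f (Q j).carrier) {u : Rn n → ℝ}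
    (hu : IntegrableOn u (unitCube n))
    (hd : Tendsto (fun j => cubeDist (rescale f (Q j)) u) atTop (𝓝 0)) :
    variation u (unitCube n) ≠ ∞ := by
  refine ne_top_of_le_ne_top (ENNReal.ofReal_ne_top (r := 1)) ?_
  rw [variation_eq_iSup_pairing]
  refine iSup₂_le fun φ hφ => ENNReal.ofReal_le_ofReal ?_
  refine le_of_tendsto' (tendsto_pairing_rescale hf hu hd hφ.isField) fun j => ?_
  exact (pairing_rescale_le_relVariation hn (hf j) Set.Subset.rfl hφ).trans
    (relVariation_le_one (hf j) Set.Subset.rfl)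

/-- Upper semicontinuity on compact sets, which fails for general `L¹` convergence through
cancellation. At a unidirectional point the variation in `K` is nearly a pairing with `η e`, and
such pairings are close to those of `u`, which `|Du|(U)` dominates. -/
theorem eventually_relVariation_le {n : ℕ} (hn : 1 ≤ n) {τ : ℝ} {f : Rn n → ℝ} {Ω : Set (Rn n)}
    {a : Rn n} (ha : ∀ ε > 0, IsUnidirectional τ f Ω ε a) {Q : ℕ → OrientedCube n}
    (hQ : IsBlowUp τ f Ω a Q) {u : Rn n → ℝ} (hu : IntegrableOn u (unitCube n))
    (hd : Tendsto (fun j => cubeDist (rescale f (Q j)) u) atTop (𝓝 0)) {K U : Set (Rn n)}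
    (hK : IsCompact K) (hU : IsOpen U) (hKU : K ⊆ U) (hU1 : U ⊆ unitCube n) {ε : ℝ}
    (hε : 0 < ε) :
    ∀ᶠ j in atTop, relVariation f (Q j) K ≤ (variation u U).toReal + ε := by
  obtain ⟨η, hη, hηc, hηU, hη01, hηK⟩ := exists_cutoff hK hU hKU
  obtain ⟨C, hC⟩ := exists_bound_divergence_smul_const hη hηc
  obtain ⟨e, he, δ, hδ, hdir⟩ := ha (ε / 2) (by positivity)
  have h1 : Tendsto (fun j => C * (cubeDist (rescale f (Q j)) u).toReal) atTop (𝓝 0) := by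
    have := ((ENNReal.tendsto_toReal ENNReal.zero_ne_top).comp hd).const_mul C
    simpa using this
  have hUfin : variation u U ≠ ∞ :=
    ne_top_of_le_ne_top (variation_unitCube_ne_top hn hQ.isBV hu hd) (variation_mono u hU1)
  filter_upwards [hd.eventually (gt_mem_nhds ENNReal.zero_lt_top),
    h1.eventually (gt_mem_nhds (half_pos hε)), hQ.side_tendsto.eventually (gt_mem_nhds hδ)]
    with j hj1 hj2 hj3
  have hpos : 0 < (variation f (Q j).carrier).toReal :=
    ENNReal.toReal_pos (hQ.variation_pos j).ne' (hQ.isBV j).2.ne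
  -- The direction is fixed at `a` in `Ω`; pulled back to `Q₀` it depends on `j`.
  set e' := (Q j).frame.symm e with he'
  have he'1 : ‖e'‖ ≤ 1 := by rwa [he', LinearIsometryEquiv.norm_map]
  have hF : IsTestField U fun x => η x • e' :=
    (IsField.cutoff_smul contDiff_const hη hηc hηU).isTestField fun x => by
      rw [norm_smul, Real.norm_of_nonneg (hη01 x).1]
      exact mul_le_one₀ (hη01 x).2 (norm_nonneg _) he'1
  have hF1 := hF.isField.mono hU1
  have hpush : (Q j).push (fun x => η x • e') = fun x => η ((Q j).invMap x) • e := by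
    funext x
    simp [OrientedCube.push, he']
  have htsupp : tsupport (fun x => η ((Q j).invMap x)) ⊆ (Q j).carrier := by
    intro x hx
    have h2 : (Q j).invMap x ∈ tsupport η :=
      tsupport_comp_subset_preimage η (Q j).homeomorph.symm.continuous hx
    exact ⟨_, hU1 (hηU h2), (Q j).map_invMap x⟩
  have h3 := hdir (Q j) ⟨hQ.subset j, hQ.isBV j, hQ.variation_pos j, hQ.mem_contraction j⟩ hj3
    (fun x => η ((Q j).invMap x)) (hη.comp (Q j).contDiff_invMap)
    (hηc.comp_homeomorph (Q j).homeomorph.symm) htsupp (fun x => hη01 _) ((Q j).map '' K) (by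
      rintro _ ⟨y, hy, rfl⟩
      simpa using hηK y hy)
  rw [← hpush] at h3
  have h4 : relVariation f (Q j) K ≤ pairing (rescale f (Q j)) (fun x => η x • e') + ε / 2 := by
    rw [pairing_rescale hn (hQ.isBV j).1 hF1, relVariation, div_le_iff₀ hpos, add_mul,
      div_mul_cancel₀ _ hpos.ne']
    exact h3
  have h5 := abs_pairing_sub_le (integrableOn_rescale (hQ.isBV j).1) hu hj1.ne hF1
    fun x => hC e' x he'1
  have h6 := pairing_le_variation hUfin hF
  have h7 := (abs_le.1 h5).2
  linarith

/-! ### Rescalings of rescalings -/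

theorem average_mul_sub {n : ℕ} {F : Rn n → ℝ} (hF : IntegrableOn F (unitCube n)) (a c : ℝ) :
    ⨍ y in unitCube n, a * (F y - c) = a * ((⨍ y in unitCube n, F y) - c) := by
  have hc : IntegrableOn (fun _ : Rn n => c) (unitCube n) :=
    integrableOn_const (volume_unitCube_lt_top n).ne
  have hvol : volume.real (unitCube n) ≠ 0 :=
    (ENNReal.toReal_pos (volume_unitCube_pos n).ne' (volume_unitCube_lt_top n).ne).ne'
  rw [setAverage_eq, setAverage_eq, integral_const_mul, integral_sub hF hc, setIntegral_const]
  simp only [smul_eq_mul]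
  field_simp

/-- Rescalings compose: the mean of `f` over `Q` cancels, and the two normalizing factors combine
into `|Df_Q|(P)`. -/
theorem rescale_comp {n : ℕ} {f : Rn n → ℝ} {Q P : OrientedCube n} (hf : IsBV f Q.carrier)
    (hpos : 0 < variation f Q.carrier) (hP : P.carrier ⊆ unitCube n) (z : Rn n) :
    rescale f (Q.comp P) z = P.side ^ (n - 1) / relVariation f Q P.carrier *
      (rescale f Q (P.map z) - ⨍ y in unitCube n, rescale f Q (P.map y)) := by
  have hV : (variation f Q.carrier).toReal ≠ 0 := (ENNReal.toReal_pos hpos.ne' hf.2.ne).ne'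
  have hint : IntegrableOn (fun y => f (Q.map (P.map y))) (unitCube n) :=
    integrableOn_comp_map ((Q.integrableOn_carrier_iff f).1 hf.1) hP
  simp only [rescale_eq f Q]
  rw [average_mul_sub hint, rescale_eq, relVariation, Q.comp_carrier P]
  simp only [OrientedCube.comp_map]
  rw [div_div_eq_mul_div, OrientedCube.comp, mul_pow]
  field_simp
  ring

/-- By `rescale_comp` it is enough that `|Df_{Q_i}|(P_i) → |Du|(R)`. The hypothesis `hle` supplies
the upper bound; the lower one comes from test fields of `R`, whose supports eventually lie in
`P_i`. -/
theorem tendsto_cubeDist_rescale_comp {n : ℕ} (hn : 1 ≤ n) {f : Rn n → ℝ}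
    {Q : ℕ → OrientedCube n} (hf : ∀ j, IsBV f (Q j).carrier)
    (hpos : ∀ j, 0 < variation f (Q j).carrier) {u : Rn n → ℝ}
    (hu : IntegrableOn u (unitCube n))
    (hd : Tendsto (fun j => cubeDist (rescale f (Q j)) u) atTop (𝓝 0))
    {P : ℕ → OrientedCube n} {R : OrientedCube n} (hPR : CubesTendsto P R)
    (hP : ∀ i, (P i).carrier ⊆ unitCube n) (hR : R.carrier ⊆ unitCube n)
    (hRpos : 0 < variation u R.carrier) {ε : ℕ → ℝ} (hε : Tendsto ε atTop (𝓝 0))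
    (hle : ∀ i, relVariation f (Q i) (P i).carrier ≤ (variation u R.carrier).toReal + ε i) :
    Tendsto (fun i => cubeDist (rescale f ((Q i).comp (P i))) (rescale u R)) atTop (𝓝 0) ∧
      ∀ᶠ i in atTop, 0 < variation f ((Q i).comp (P i)).carrier := by
  have hRfin : variation u R.carrier ≠ ∞ :=
    ne_top_of_le_ne_top (variation_unitCube_ne_top hn hf hu hd) (variation_mono u hR)
  have hRpos' : 0 < (variation u R.carrier).toReal := ENNReal.toReal_pos hRpos.ne' hRfin
  have hlow : ∀ c < (variation u R.carrier).toReal,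
      ∀ᶠ i in atTop, c < relVariation f (Q i) (P i).carrier := by
    intro c hc
    obtain ⟨φ, hφ, hcφ⟩ := exists_lt_pairing_of_lt_toReal hc
    exact eventually_lt_relVariation hn hf hu hd (hφ.mono hR) hP
      (hPR.eventually_subset hφ.hasCompactSupport hφ.tsupport_subset) hcφ
  have hratio : Tendsto (fun i => relVariation f (Q i) (P i).carrier) atTop
      (𝓝 (variation u R.carrier).toReal) := by
    rw [tendsto_order]
    refine ⟨hlow, fun c hc => ?_⟩
    have h1 : Tendsto (fun i => (variation u R.carrier).toReal + ε i) atTop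
        (𝓝 (variation u R.carrier).toReal) := by
      simpa using hε.const_add (variation u R.carrier).toReal
    filter_upwards [h1.eventually (gt_mem_nhds hc)] with i hi
    exact (hle i).trans_lt hi
  refine ⟨?_, ?_⟩
  · have hH : ∀ i, IntegrableOn (fun y => rescale f (Q i) ((P i).map y)) (unitCube n) := fun i =>
      integrableOn_comp_map (integrableOn_rescale (hf i).1) (hP i)
    have hdist : Tendsto (fun i => cubeDist (fun y => rescale f (Q i) ((P i).map y))
        fun y => u (R.map y)) atTop (𝓝 0) := by
      have h1 : Tendsto (fun i => (ENNReal.ofReal ((P i).side ^ n))⁻¹ *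
          cubeDist (rescale f (Q i)) u +
          cubeDist (fun y => u ((P i).map y)) fun y => u (R.map y)) atTop (𝓝 0) := by
        have h2 := ENNReal.Tendsto.mul hPR.inv_ofReal (Or.inr ENNReal.zero_ne_top) hd
          (Or.inr (inv_ofReal_side_pow_ne_top R))
        simpa using h2.add (hPR.cubeDist_comp hP hR hu)
      refine tendsto_of_tendsto_of_tendsto_of_le_of_le tendsto_const_nhds h1
        (fun _ => zero_le) fun i => ?_
      refine (cubeDist_triangle _ (hH i) (integrableOn_comp_map hu (hP i))).trans ?_
      gcongr
      exact cubeDist_comp_map_le _ u (hP i)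
    have h3 := tendsto_cubeDist_mul_sub_average hH (integrableOn_comp_map hu hR) hdist
      ((hPR.side.pow (n - 1)).div hratio hRpos'.ne')
    have h4 : rescale u R = fun y => R.side ^ (n - 1) / (variation u R.carrier).toReal *
        (u (R.map y) - ⨍ z in unitCube n, u (R.map z)) := funext fun y => rescale_eq u R y
    have h5 : ∀ i, rescale f ((Q i).comp (P i)) = fun y =>
        (P i).side ^ (n - 1) / relVariation f (Q i) (P i).carrier *
        (rescale f (Q i) ((P i).map y) - ⨍ z in unitCube n, rescale f (Q i) ((P i).map z)) :=
      fun i => funext fun y => rescale_comp (hf i) (hpos i) (hP i) y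
    simpa only [h4, h5, Pi.div_apply] using h3
  · filter_upwards [hlow 0 hRpos'] with i hi
    rw [pos_iff_ne_zero, OrientedCube.comp_carrier]
    intro h0
    rw [relVariation, h0] at hi
    simp at hi

/-! ### Perturbations of cubes -/

/-- The cube `T_Q(w + sQ₀)`. -/
def OrientedCube.perturb {n : ℕ} (Q : OrientedCube n) (s : ℝ) (hs : 0 < s) (w : Rn n) :
    OrientedCube n :=
  Q.comp ⟨w, s, hs, LinearIsometryEquiv.refl ℝ (Rn n)⟩

theorem OrientedCube.perturb_map {n : ℕ} (Q : OrientedCube n) {s : ℝ} (hs : 0 < s) (w y : Rn n) :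
    (Q.perturb s hs w).map y = Q.map (w + s • y) :=
  Q.comp_map _ y

theorem OrientedCube.map_mem_perturb_contraction {n : ℕ} (Q : OrientedCube n) {s : ℝ} (hs : 0 < s)
    (w : Rn n) {τ : ℝ} {z : Rn n} (hz : s⁻¹ • z ∈ unitCube n) :
    Q.map (w + τ • z) ∈ (Q.perturb s hs w).contraction τ := by
  refine ⟨s⁻¹ • z, hz, ?_⟩
  simp only [perturb_map]
  rw [smul_comm τ, smul_smul, mul_inv_cancel₀ hs.ne', one_smul]

/-- The closed cube `θQ₀`. -/
def closedCube (n : ℕ) (θ : ℝ) : Set (Rn n) := {y | ∀ i, |y i| ≤ θ / 2}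

theorem closedCube_subset_unitCube (n : ℕ) {θ : ℝ} (hθ : θ < 1) : closedCube n θ ⊆ unitCube n :=
  fun y hy i => (hy i).trans_lt (by linarith)

theorem isCompact_closedCube (n : ℕ) {θ : ℝ} (hθ : θ < 1) : IsCompact (closedCube n θ) := by
  refine Metric.isCompact_of_isClosed_isBounded ?_ ?_
  · simp only [closedCube, Set.ofPred_forall]
    exact isClosed_iInter fun i => isClosed_le (by fun_prop) continuous_const
  · refine (Metric.isBounded_iff_subset_closedBall 0).2 ⟨n, fun y hy => ?_⟩
    exact mem_closedBall_zero_iff.2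
      (norm_le_of_mem_unitCube (closedCube_subset_unitCube n hθ hy))

/-- Since `(1 - s) / 4 + s / 2 = (1 + s) / 4`, all shifts of this size stay in one compact subset of
`Q`, to which the upper bound for the variation applies uniformly in `w`. -/
theorem OrientedCube.perturb_carrier_subset {n : ℕ} (Q : OrientedCube n) {s : ℝ} (hs : 0 < s)
    {w : Rn n} (hw : ‖w‖ < (1 - s) / 4) :
    (Q.perturb s hs w).carrier ⊆ Q.map '' closedCube n ((1 + s) / 2) := by
  rintro _ ⟨y, hy, rfl⟩
  refine ⟨w + s • y, fun i => ?_, (Q.perturb_map hs w y).symm⟩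
  have h1 := hy i
  have h2 := abs_apply_le_norm w i
  simp only [PiLp.add_apply, PiLp.smul_apply, smul_eq_mul]
  calc |w i + s * y i| ≤ |w i| + |s * y i| := abs_add_le _ _
    _ = |w i| + s * |y i| := by rw [abs_mul, abs_of_pos hs]
    _ ≤ (1 + s) / 2 / 2 := by nlinarith

theorem cubesTendsto_perturb {n : ℕ} (Q : OrientedCube n) {s : ℕ → ℝ} (hs : ∀ i, 0 < s i)
    (hs1 : Tendsto s atTop (𝓝 1)) {w : ℕ → Rn n} (hw : Tendsto w atTop (𝓝 0)) :
    CubesTendsto (fun i => Q.perturb (s i) (hs i) (w i)) Q where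
  center := by
    have h1 : Q.map 0 = Q.center := by simp [OrientedCube.map]
    have h2 := (Q.continuous_map.tendsto 0).comp hw
    rwa [h1] at h2
  side := by
    have h := hs1.const_mul Q.side
    rwa [mul_one] at h
  frame i := by
    ext y
    rfl

/-- The rescaling `u_R` of a tangent `u` is approximated by the rescalings of `f` in all slight
perturbations of the corresponding cubes. -/
theorem exists_perturb_cubeDist_lt {n : ℕ} (hn : 1 ≤ n) {τ : ℝ} {f : Rn n → ℝ}
    {Ω : Set (Rn n)} {a : Rn n} (ha : ∀ ε > 0, IsUnidirectional τ f Ω ε a)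
    {Q : ℕ → OrientedCube n} (hQ : IsBlowUp τ f Ω a Q) {u : Rn n → ℝ}
    (hu : IntegrableOn u (unitCube n))
    (hd : Tendsto (fun j => cubeDist (rescale f (Q j)) u) atTop (𝓝 0)) {R : OrientedCube n}
    (hR : R.carrier ⊆ unitCube n) (hRpos : 0 < variation u R.carrier) {z : Rn n}
    (hz : z ∈ unitCube n) {ε : ℝ≥0∞} (hε : ε ≠ 0) :
    ∃ (s : ℝ) (hs : 0 < s), s < 1 ∧ ∃ δ > 0, ∃ J, ∀ j ≥ J, ∀ w, ‖w‖ < δ →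
      (R.perturb s hs w).carrier ⊆ unitCube n ∧
      R.map (w + τ • z) ∈ (R.perturb s hs w).contraction τ ∧
      0 < variation f ((Q j).comp (R.perturb s hs w)).carrier ∧
      cubeDist (rescale f ((Q j).comp (R.perturb s hs w))) (rescale u R) < ε := by
  -- Otherwise there are bad cubes with `s → 1`, `w → 0` and `j → ∞`; they converge to `R`, against
  -- `tendsto_cubeDist_rescale_comp`.
  by_contra! hcon
  set s : ℕ → ℝ := fun i => 1 - 1 / ((i : ℝ) + 2) with hsdef
  have hi2 : ∀ i : ℕ, (0 : ℝ) < (i : ℝ) + 2 := fun i => by positivity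
  have hs : ∀ i, 0 < s i := fun i => by
    simp only [hsdef, sub_pos]
    rw [div_lt_one (hi2 i)]
    have : (0 : ℝ) ≤ i := Nat.cast_nonneg i
    linarith
  have hs1 : ∀ i, s i < 1 := fun i => by
    have := one_div_pos.2 (hi2 i)
    simp only [hsdef]
    linarith
  have hinv : Tendsto (fun i : ℕ => 1 / ((i : ℝ) + 2)) atTop (𝓝 0) := by
    have h1 := tendsto_one_div_add_atTop_nhds_zero_nat (𝕜 := ℝ)
    refine squeeze_zero (fun i => (one_div_pos.2 (hi2 i)).le) (fun i => ?_) h1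
    exact one_div_le_one_div_of_le (by positivity) (by linarith)
  have hslim : Tendsto s atTop (𝓝 1) := by
    have h := hinv.const_sub 1
    rwa [sub_zero] at h
  have hθ : ∀ i, (1 + s i) / 2 < 1 := fun i => by linarith [hs1 i]
  have hKR : ∀ i, R.map '' closedCube n ((1 + s i) / 2) ⊆ R.carrier := fun i =>
    Set.image_mono (closedCube_subset_unitCube n (hθ i))
  have hJ : ∀ i : ℕ, ∃ J, ∀ j ≥ J, relVariation f (Q j) (R.map '' closedCube n ((1 + s i) / 2)) ≤
      (variation u R.carrier).toReal + 1 / ((i : ℝ) + 2) := fun i =>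
    eventually_atTop.1 (eventually_relVariation_le hn ha hQ hu hd
      ((isCompact_closedCube n (hθ i)).image R.continuous_map) R.isOpen_carrier (hKR i) hR
      (one_div_pos.2 (hi2 i)))
  choose J hJ using hJ
  -- The index is taken beyond `J i`, for the upper bound on the variation, and beyond `i`, to make
  -- it tend to infinity.
  have hbad := fun i => hcon (s i) (hs i) (hs1 i) ((1 - s i) / 4) (by linarith [hs1 i])
    (max (J i) i)
  choose j hj w hw hbad using hbad
  set P : ℕ → OrientedCube n := fun i => R.perturb (s i) (hs i) (w i)
  have hjtop : Tendsto j atTop atTop :=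
    tendsto_atTop_mono (fun i => (le_max_right _ _).trans (hj i)) tendsto_id
  have hwlim : Tendsto w atTop (𝓝 0) := by
    have h1 : Tendsto (fun i => (1 - s i) / 4) atTop (𝓝 0) := by
      simpa using (hslim.const_sub 1).div_const 4
    exact squeeze_zero_norm (fun i => (hw i).le) h1
  have hPK : ∀ i, (P i).carrier ⊆ R.map '' closedCube n ((1 + s i) / 2) := fun i =>
    R.perturb_carrier_subset (hs i) (hw i)
  have hPcube : ∀ i, (P i).carrier ⊆ unitCube n := fun i => ((hPK i).trans (hKR i)).trans hR
  obtain ⟨hdist, hpos⟩ := tendsto_cubeDist_rescale_comp hn (fun i => hQ.isBV (j i))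
    (fun i => hQ.variation_pos (j i)) hu (hd.comp hjtop) (cubesTendsto_perturb R hs hslim hwlim)
    hPcube hR hRpos hinv fun i =>
      (relVariation_mono (hQ.isBV (j i)) (hPK i) ((hKR i).trans hR)).trans
        (hJ i (j i) ((le_max_left _ _).trans (hj i)))
  have hzlim : Tendsto (fun i => (s i)⁻¹ • z) atTop (𝓝 z) := by
    simpa using (hslim.inv₀ one_ne_zero).smul_const z
  obtain ⟨i, hi1, hi2, hi3⟩ := (hpos.and ((hdist.eventually
    (gt_mem_nhds (pos_iff_ne_zero.2 hε))).and
      (hzlim.eventually ((isOpen_unitCube n).mem_nhds hz)))).exists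
  exact (hbad i (hPcube i) (R.map_mem_perturb_contraction (hs i) (w i) hi3) hi1).not_gt hi2

/-! ### Tangents -/

theorem mem_Tan_iff {n : ℕ} {τ : ℝ} {f : Rn n → ℝ} {Ω : Set (Rn n)} {a : Rn n} {u : Rn n → ℝ} :
    u ∈ Tan τ f Ω a ↔ a ∈ spt f Ω ∧ IntegrableOn u (unitCube n) ∧
      ∀ ε : ℝ, 0 < ε → ∃ Q, IsAdmissible τ f Ω a Q ∧ Q.side < ε ∧
        cubeDist (rescale f Q) u < ENNReal.ofReal ε := by
  constructor
  · rintro ⟨ha, hu, Q, hQ, hd⟩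
    refine ⟨ha, hu, fun ε hε => ?_⟩
    obtain ⟨j, hj1, hj2⟩ := ((hQ.side_tendsto.eventually (gt_mem_nhds hε)).and
      (hd.eventually (gt_mem_nhds (ENNReal.ofReal_pos.2 hε)))).exists
    exact ⟨Q j, ⟨hQ.subset j, hQ.isBV j, hQ.variation_pos j, hQ.mem_contraction j⟩, hj1, hj2⟩
  · rintro ⟨ha, hu, h⟩
    choose Q hQ hs hd using fun j : ℕ => h (1 / ((j : ℝ) + 1)) (by positivity)
    have hlim := tendsto_one_div_add_atTop_nhds_zero_nat (𝕜 := ℝ)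
    refine ⟨ha, hu, Q, ⟨fun j => (hQ j).subset, fun j => (hQ j).isBV,
      fun j => (hQ j).variation_pos, fun j => (hQ j).mem_contraction,
      squeeze_zero (fun j => (Q j).side_pos.le) (fun j => (hs j).le) hlim⟩, ?_⟩
    have h1 := ENNReal.tendsto_ofReal hlim
    rw [ENNReal.ofReal_zero] at h1
    exact tendsto_of_tendsto_of_tendsto_of_le_of_le tendsto_const_nhds h1 (fun _ => zero_le)
      fun j => (hd j).le

theorem mem_Tan_of_forall_cubeDist_lt {n : ℕ} {τ : ℝ} {f : Rn n → ℝ} {Ω : Set (Rn n)} {a : Rn n}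
    {v : Rn n → ℝ} (ha : a ∈ spt f Ω) (hv : IntegrableOn v (unitCube n))
    (h : ∀ ε : ℝ, 0 < ε → ∃ u ∈ Tan τ f Ω a, cubeDist u v < ENNReal.ofReal ε) :
    v ∈ Tan τ f Ω a := by
  refine mem_Tan_iff.2 ⟨ha, hv, fun ε hε => ?_⟩
  obtain ⟨u, hu, huv⟩ := h (ε / 2) (by positivity)
  obtain ⟨-, hui, hu⟩ := mem_Tan_iff.1 hu
  obtain ⟨Q, hQ, hs, hd⟩ := hu (ε / 2) (by positivity)
  refine ⟨Q, hQ, by linarith, ?_⟩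
  calc cubeDist (rescale f Q) v ≤ cubeDist (rescale f Q) u + cubeDist u v :=
        cubeDist_triangle v (integrableOn_rescale hQ.isBV.1) hui
    _ < ENNReal.ofReal (ε / 2) + ENNReal.ofReal (ε / 2) := ENNReal.add_lt_add hd huv
    _ = ENNReal.ofReal ε := by
      rw [← ENNReal.ofReal_add (by positivity) (by positivity), add_halves]

theorem exists_countable_dense_cubeDist (n : ℕ) :
    ∃ g : ℕ → Rn n → ℝ, (∀ m, IntegrableOn (g m) (unitCube n)) ∧
      ∀ u : Rn n → ℝ, IntegrableOn u (unitCube n) → ∀ ε : ℝ≥0∞, ε ≠ 0 →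
        ∃ m, cubeDist u (g m) < ε := by
  have : Fact ((1 : ℝ≥0∞) ≠ ∞) := ⟨ENNReal.one_ne_top⟩
  set μ := (volume : Measure (Rn n)).restrict (unitCube n)
  refine ⟨fun m => TopologicalSpace.denseSeq (Lp ℝ 1 μ) m, fun m => L1.integrable_coeFn _,
    fun u hu ε hε => ?_⟩
  obtain ⟨m, hm⟩ := (TopologicalSpace.denseRange_denseSeq (Lp ℝ 1 μ)).exists_mem_open
    (Metric.isOpen_eball (x := hu.toL1 u) (ε := ε)) ⟨_, Metric.mem_eball_self (pos_iff_ne_zero.2 hε)⟩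
  refine ⟨m, ?_⟩
  rw [Metric.mem_eball, edist_comm, L1.edist_def] at hm
  refine lt_of_eq_of_lt (lintegral_congr_ae ?_) hm
  filter_upwards [hu.coeFn_toL1] with y hy
  rw [edist_eq_enorm_sub, hy]

/-! ### The exceptional set and its nullity. -/

theorem variation_pos_of_mem_spt {n : ℕ} {u : Rn n → ℝ} {Ω U : Set (Rn n)} {y : Rn n}
    (hy : y ∈ spt u Ω) (hU : IsOpen U) (hUΩ : U ⊆ Ω) (hyU : y ∈ U) : 0 < variation u U :=
  hy.2 U hU hUΩ hyU

/-- The points of `Ω` with a tangent that has a rescaling `ε`-close to `g`, although the rescalings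
of `f` in the small cubes around them stay `2ε`-away from `g`. -/
def isolatedSet {n : ℕ} (τ : ℝ) (f : Rn n → ℝ) (Ω : Set (Rn n)) (g : Rn n → ℝ) (ε : ℝ) :
    Set (Rn n) :=
  {a | a ∈ Ω ∧ (∀ ε > 0, IsUnidirectional τ f Ω ε a) ∧
    (∃ u ∈ Tan τ f Ω a, ∃ R : OrientedCube n, R.carrier ⊆ unitCube n ∧
      (R.contraction τ ∩ spt u (unitCube n)).Nonempty ∧
      cubeDist (rescale u R) g < ENNReal.ofReal ε) ∧
    ∀ Q, IsAdmissible τ f Ω a Q → Q.side < ε →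
      ENNReal.ofReal (2 * ε) ≤ cubeDist (rescale f Q) g}

/-- Near a point of `spt |Du|` in `τR`, every point transported by `T_{Q_j}` has an admissible cube
whose rescaling is `ε`-close to `u_R`, hence less than `2ε` from `g`. So a whole ball, charged by
`|Du|`, is transported outside the set. -/
theorem isolatedSet_sparse {n : ℕ} (hn : 1 ≤ n) {τ : ℝ} (h0 : 0 ≤ τ) (h1 : τ < 1)
    {f : Rn n → ℝ} {Ω : Set (Rn n)} {g : Rn n → ℝ} {ε : ℝ}
    (hε : 0 < ε) {a : Rn n} (ha : a ∈ isolatedSet τ f Ω g ε) :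
    ∃ c : ℝ, 0 < c ∧ ∀ δ > 0, ∃ Q, IsAdmissible τ f Ω a Q ∧ Q.side < δ ∧
      ∃ O : Set (Rn n), IsOpen O ∧ O ⊆ Q.carrier ∧ Disjoint O (isolatedSet τ f Ω g ε) ∧
        c * (variation f Q.carrier).toReal ≤ (variation f O).toReal := by
  obtain ⟨-, hdir, ⟨u, ⟨-, hu, Q, hQ, hd⟩, R, hR, ⟨y, hyR, hy⟩, hRg⟩, -⟩ := ha
  replace hd : Tendsto (fun j => cubeDist (rescale f (Q j)) u) atTop (𝓝 0) := hd
  have hRpos : 0 < variation u R.carrier := variation_pos_of_mem_spt hy R.isOpen_carrier hR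
    (R.contraction_subset_carrier h0 h1 hyR)
  obtain ⟨z, hz, rfl⟩ := hyR
  obtain ⟨s, hs, hs1, δ₁, hδ₁, J, hJ⟩ := exists_perturb_cubeDist_lt hn hdir hQ hu hd hR hRpos hz
    (ENNReal.ofReal_pos.2 hε).ne'
  obtain ⟨δ₂, hδ₂, hball⟩ := Metric.isOpen_iff.1 (isOpen_unitCube n) _
    (smul_mem_unitCube hz h0 h1.le)
  -- The radius `δ₁` keeps the shifts `w` admissible for the perturbed cubes, and `δ₂` keeps the
  -- ball inside `Q₀`.
  set B := R.map '' Metric.ball (τ • z) (min δ₁ δ₂) with hB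
  have hBR : B ⊆ R.carrier :=
    Set.image_mono ((Metric.ball_subset_ball (min_le_right _ _)).trans hball)
  have hBcube := hBR.trans hR
  have hBo : IsOpen B := R.isOpen_map_image Metric.isOpen_ball
  have hBpos : 0 < variation u B := variation_pos_of_mem_spt hy hBo hBcube
    ⟨_, Metric.mem_ball_self (lt_min hδ₁ hδ₂), rfl⟩
  obtain ⟨φ, hφ, hφpos⟩ := exists_lt_pairing (f := u) (U := B) (c := 0) (by simpa using hBpos)
  have hc := eventually_lt_relVariation hn hQ.isBV hu hd (hφ.mono hBcube) (V := fun _ => B)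
    (fun _ => hBcube) (Filter.Eventually.of_forall fun _ => hφ.tsupport_subset)
    (half_lt_self hφpos)
  refine ⟨pairing u φ / 2, half_pos hφpos, fun δ hδ => ?_⟩
  have hside : ∀ᶠ j in atTop, (Q j).side * R.side < ε := by
    have := hQ.side_tendsto.mul_const R.side
    rw [zero_mul] at this
    exact this.eventually (gt_mem_nhds hε)
  obtain ⟨j, hj1, hj2, hj3, hj4⟩ := (hc.and (hside.and ((hQ.side_tendsto.eventually
    (gt_mem_nhds hδ)).and (eventually_ge_atTop J)))).exists
  have hpos : 0 < (variation f (Q j).carrier).toReal :=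
    ENNReal.toReal_pos (hQ.variation_pos j).ne' (hQ.isBV j).2.ne
  refine ⟨Q j, ⟨hQ.subset j, hQ.isBV j, hQ.variation_pos j, hQ.mem_contraction j⟩, hj3,
    (Q j).map '' B, (Q j).isOpen_map_image hBo, Set.image_mono hBcube, ?_, ?_⟩
  · rw [Set.disjoint_left]
    rintro _ ⟨_, ⟨x, hx, rfl⟩, rfl⟩ ha'
    set w := x - τ • z with hw
    have hxw : x = w + τ • z := by simp [hw]
    have hwδ : ‖w‖ < δ₁ := by
      rw [hw, ← dist_eq_norm]
      exact (Metric.mem_ball.1 hx).trans_le (min_le_left _ _)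
    obtain ⟨hP, hmem, hPpos, hPd⟩ := hJ j hj4 w hwδ
    set P := R.perturb s hs w
    have hsub := (Q j).comp_carrier_subset hP
    have hadm : IsAdmissible τ f Ω ((Q j).map (R.map x)) ((Q j).comp P) :=
      ⟨hsub.trans (hQ.subset j), ⟨(hQ.isBV j).1.mono_set hsub,
        (variation_mono f hsub).trans_lt (hQ.isBV j).2⟩, hPpos, by
          rw [hxw]
          exact (Q j).map_mem_comp_contraction hmem⟩
    have hPside : ((Q j).comp P).side < ε := by
      have h2 : ((Q j).comp P).side = (Q j).side * R.side * s := by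
        change (Q j).side * (R.side * s) = _
        ring
      rw [h2]
      have := mul_pos (Q j).side_pos R.side_pos
      nlinarith
    refine (ha'.2.2.2 _ hadm hPside).not_gt ?_
    calc cubeDist (rescale f ((Q j).comp P)) g
        ≤ cubeDist (rescale f ((Q j).comp P)) (rescale u R) + cubeDist (rescale u R) g :=
          cubeDist_triangle g (integrableOn_rescale hadm.isBV.1)
            (integrableOn_rescale (hu.mono_set hR))
      _ < ENNReal.ofReal ε + ENNReal.ofReal ε := ENNReal.add_lt_add hPd hRg
      _ = ENNReal.ofReal (2 * ε) := by
        rw [← ENNReal.ofReal_add hε.le hε.le, two_mul]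
  · rw [relVariation, lt_div_iff₀ hpos] at hj1
    exact hj1.le

/-- The fraction `c` depends on the point, so the set is exhausted by the countably many cases `c ≥
1 / (p + 1)`. -/
theorem outerVariation_isolatedSet {n : ℕ} (hn : 1 ≤ n) {τ : ℝ} (h0 : 0 ≤ τ) (h1 : τ < 1)
    {f : Rn n → ℝ} {Ω : Set (Rn n)} (hΩ : IsOpen Ω) (hf : IsBVLoc f Ω) (g : Rn n → ℝ) {ε : ℝ}
    (hε : 0 < ε) : outerVariation f Ω (isolatedSet τ f Ω g ε) = 0 := by
  refine measure_mono_null (fun a ha => ?_) (measure_iUnion_null fun p : ℕ =>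
    outerVariation_sparse_eq_zero hΩ hf h0 h1 (A := isolatedSet τ f Ω g ε)
      (c := 1 / ((p : ℝ) + 1)) (by positivity))
  obtain ⟨c, hc, h⟩ := isolatedSet_sparse hn h0 h1 hε ha
  obtain ⟨p, hp⟩ := exists_nat_one_div_lt hc
  refine Set.mem_iUnion.2 ⟨p, ha, ha.1, fun δ hδ => ?_⟩
  obtain ⟨Q, hQ, hs, O, hO, hOQ, hdis, hle⟩ := h δ hδ
  exact ⟨Q, hQ, hs, O, hO, hOQ, hdis, le_trans (by gcongr) hle⟩

theorem outerVariation_rescale_notMem_Tan {n : ℕ} (hn : 1 ≤ n) {τ : ℝ} (h0 : 0 ≤ τ) (h1 : τ < 1)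
    {f : Rn n → ℝ} {Ω : Set (Rn n)} (hΩ : IsOpen Ω) (hf : IsBVLoc f Ω) :
    outerVariation f Ω {a | a ∈ Ω ∧ ∃ u ∈ Tan τ f Ω a, ∃ R : OrientedCube n,
      R.carrier ⊆ unitCube n ∧ (R.contraction τ ∩ spt u (unitCube n)).Nonempty ∧
      rescale u R ∉ Tan τ f Ω a} = 0 := by
  obtain ⟨g, hg, hgd⟩ := exists_countable_dense_cubeDist n
  have hnull1 := measure_iUnion_null fun k : ℕ => outerVariation_not_isUnidirectional hΩ hf h0 h1
    (ε := 1 / ((k : ℝ) + 1)) (by positivity)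
  have hnull2 := measure_iUnion_null fun k : ℕ => measure_iUnion_null fun m : ℕ =>
    outerVariation_isolatedSet hn h0 h1 hΩ hf (g m) (ε := 1 / ((k : ℝ) + 1)) (by positivity)
  refine measure_mono_null (fun a ha => ?_) (measure_union_null hnull1 hnull2)
  obtain ⟨haΩ, u, hu, R, hR, hRs, hnot⟩ := ha
  by_cases hdir : ∀ k : ℕ, IsUnidirectional τ f Ω (1 / ((k : ℝ) + 1)) a
  swap
  · push Not at hdir
    obtain ⟨k, hk⟩ := hdir
    exact Or.inl (Set.mem_iUnion.2 ⟨k, haΩ, hk⟩)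
  right
  have hdir' : ∀ ε > 0, IsUnidirectional τ f Ω ε a := fun ε hε => by
    obtain ⟨k, hk⟩ := exists_nat_one_div_lt hε
    obtain ⟨e, he, δ, hδ, h⟩ := hdir k
    refine ⟨e, he, δ, hδ, fun Q hQ hs η hη hηc hηQ hη01 O hO => ?_⟩
    refine (h Q hQ hs η hη hηc hηQ hη01 O hO).trans ?_
    gcongr
  have huR : IntegrableOn (rescale u R) (unitCube n) := integrableOn_rescale (hu.2.1.mono_set hR)
  rw [mem_Tan_iff] at hnot
  push Not at hnot
  obtain ⟨ε, hε, hfar⟩ := hnot hu.1 huR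
  -- With `u_R` within `κ` of `g m`, a rescaling of `f` within `2κ` of `g m` would be within `3κ <
  -- ε` of `u_R`.
  obtain ⟨k, hk⟩ := exists_nat_one_div_lt (show 0 < ε / 3 by positivity)
  set κ : ℝ := 1 / ((k : ℝ) + 1) with hκ
  have hκ0 : 0 < κ := by positivity
  obtain ⟨m, hm⟩ := hgd _ huR (ENNReal.ofReal κ) (ENNReal.ofReal_pos.2 hκ0).ne'
  refine Set.mem_iUnion₂.2 ⟨k, m, haΩ, hdir', ⟨u, hu, R, hR, hRs, hm⟩, fun Q hQ hs => ?_⟩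
  by_contra! hlt
  refine (hfar Q hQ (hs.trans (by linarith))).not_gt ?_
  calc cubeDist (rescale f Q) (rescale u R)
      = cubeDist (rescale u R) (rescale f Q) := cubeDist_comm _ _
    _ ≤ cubeDist (rescale u R) (g m) + cubeDist (g m) (rescale f Q) :=
      cubeDist_triangle _ huR (hg m)
    _ < ENNReal.ofReal κ + ENNReal.ofReal (2 * κ) := ENNReal.add_lt_add hm (by rwa [cubeDist_comm])
    _ ≤ ENNReal.ofReal ε := by
      rw [← ENNReal.ofReal_add hκ0.le (by positivity)]
      exact ENNReal.ofReal_le_ofReal (by linarith)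

end BVTangent

end

theorem proposition5p8 (n : ℕ) (hn : 1 ≤ n) (Ω : Set (BVTangent.Rn n)) (hΩ : IsOpen Ω)
    (f : BVTangent.Rn n → ℝ) (hf : BVTangent.IsBVLoc f Ω) (τ : ℝ) (hτ0 : 0 ≤ τ) (hτ1 : τ < 1) :
    ∀ᵐ a ∂(BVTangent.totalVariation f Ω), ∀ u ∈ BVTangent.Tan τ f Ω a,
      (∀ Q : BVTangent.OrientedCube n, Q.carrier ⊆ BVTangent.unitCube n →
        (Q.contraction τ ∩ BVTangent.spt u (BVTangent.unitCube n)).Nonempty →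
          BVTangent.rescale u Q ∈ BVTangent.Tan τ f Ω a) ∧
      (∀ y ∈ BVTangent.spt u (BVTangent.unitCube n),
        BVTangent.Tan τ u (BVTangent.unitCube n) y ⊆ BVTangent.Tan τ f Ω a) := by
  rw [ae_iff, BVTangent.totalVariation_apply]
  refine measure_mono_null ?_
    (BVTangent.outerVariation_rescale_notMem_Tan hn hτ0 hτ1 hΩ hf)
  rintro a ⟨ha, haΩ⟩
  refine ⟨haΩ, ?_⟩
  by_contra! hcon
  -- A tangent `v` of `u` at `y` is an `L¹` limit of rescalings `u_P` with `y ∈ τP ∩ spt |Du|`;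
  -- these are tangents of `f` by the first assertion, and the tangent set is closed.
  refine ha fun u hu => ⟨hcon u hu, fun y hy v hv => ?_⟩
  obtain ⟨-, hvi, hv⟩ := BVTangent.mem_Tan_iff.1 hv
  refine BVTangent.mem_Tan_of_forall_cubeDist_lt hu.1 hvi fun ε hε => ?_
  obtain ⟨P, hP, -, hd⟩ := hv ε hε
  exact ⟨_, hcon u hu P hP.subset ⟨y, hP.mem_contraction, hy⟩, hd⟩
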